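/- Conventions: $R_{jkl}{}^m$ is the Riemann tensor of the Levi-Civita connection with $[\nabla_j,\nabla_k]u_l=R_{jkl}{}^m u_m$, $R_{ab}=R_{amb}{}^m$ is the Ricci tensor, $R=g^{ab}R_{ab}$, and the Weyl tensor of an $n$-dimensional pseudo-Riemannian manifold, $n\ge 3$, is $$C_{jkl}{}^m=R_{jkl}{}^m+\tfrac{1}{n-2}\big(\delta_j{}^mR_{kl}-\delta_k{}^mR_{jl}+R_j{}^mg_{kl}-R_k{}^mg_{jl}\big)-\tfrac{R}{(n-1)(n-2)}\big(\delta_j{}^mg_{kl}-\delta_k{}^mg_{jl}\big).$$ Let $K$ be the Riemann or the Weyl tensor. A symmetric tensor $b_{ij}$ is called $K$-compatible (Riemann compatible, Weyl compatible) if $b_{am}K_{bcl}{}^m+b_{bm}K_{cal}{}^m+b_{cm}K_{abl}{}^m=0$. A vector $u$ is called $K$-compatible if $(u_iK_{jkl}{}^m+u_jK_{kil}{}^m+u_kK_{ijl}{}^m)u_m=0$. **Theorem.** Let $(M_n,g)$ and $(V_{n+1},\tilde g)$ be smooth pseudo-Riemannian manifolds of arbitrary signature and of dimensions $n\ge 3$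 and $n+1$. Suppose that $V_{n+1}$ has constant curvature, i.e. $\tilde R_{\mu\nu\rho\sigma}=\kappa(\tilde g_{\mu\rho}\tilde g_{\nu\sigma}-\tilde g_{\mu\sigma}\tilde g_{\nu\rho})$ for a constant $\kappa$, and let $f:M_n\to V_{n+1}$ be a smooth isometric immersion, $g=f^*\tilde g$ (in particular, $f$ may be an isometric embedding). At each point of $M_n$, let $N$ be any unit normal vector, $\tilde g(N,N)=\pm1$, and let $\Omega_{jl}=\tilde g(\tilde\nabla_{B_j}B_l,N)$ be the second fundamental form, where the $B_j$ are the coordinate tangent vectors of the hypersurface. Then, at each point of $M_n$: 1. $\Omega$ is Riemann compatible and Weyl compatible. 2. Every eigenvector $u$ of $\Omega$ ($\Omega_{km}u^m=\lambda u_k$, $u\ne0$, $\lambda$ real) is Riemann compatible and Weyl compatible. 3. The Ricci tensor $R_{ij}$ of $M_n$ is Riemann compatible and Weyl compatible. 4. The energy-momentum tensor $T_{ij}$, defined by Einstein's equations $R_{ij}-\frac R2 g_{ij}=8\pi T_{ij}$, is Weyl compatible. 5. If, at the given point, $T_{kl}=a\,u_ku_l+b\,g_{kl}$ with real $a\neq0$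 and $b$, and with a vector $u$ such that $u^iu_i=-1$, then $u$ is Weyl compatible and the Weyl tensor is purely electric with respect to $u$. The latter means that its magnetic part vanishes: $C_{jklm}x^jy^kz^lu^m=0$ for all vectors $x,y,z$ orthogonal to $u$. If $n=4$, it also holds that $H_{ab}=u^ju^m\tilde C_{jabm}=0$, where $\tilde C_{abcd}=\frac12\epsilon_{abrs}C^{rs}{}_{cd}$ and $\epsilon$ is the volume form of $g$. -/

import Mathlib

open scoped Manifold ContDiff

namespace WeylCompat

noncomputable section

/-- The model space `ℝⁿ`. The tangent space at every point of a manifold modelled on it is (by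
definition) a copy of `ℝⁿ`: a tangent vector at `p` is given by its components in the coordinate
frame of the preferred chart at `p`. -/
abbrev Coord (n : ℕ) : Type := EuclideanSpace ℝ (Fin n)

/-- The `i`-th coordinate vector. -/
def e {n : ℕ} (i : Fin n) : Coord n := EuclideanSpace.single i (1 : ℝ)

/-- The partial derivative `∂ᵢ F` at `x`. -/
def pd {n : ℕ} {W : Type*} [NormedAddCommGroup W] [NormedSpace ℝ W]
    (i : Fin n) (F : Coord n → W) (x : Coord n) : W :=
  fderiv ℝ F x (e i)

/-! ### Local formulas, for a matrix of metric coefficients `G` on `ℝⁿ` -/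

/-- Christoffel symbols `Γᵏᵢⱼ = ½ gᵏˡ (∂ᵢ gⱼₗ + ∂ⱼ gᵢₗ - ∂ₗ gᵢⱼ)` (arguments in the order `k i j`). -/
def christoffel {n : ℕ} (G : Coord n → Matrix (Fin n) (Fin n) ℝ) (k i j : Fin n)
    (x : Coord n) : ℝ :=
  (1 / 2) * ∑ l, (G x)⁻¹ k l *
    (pd i (fun y => G y j l) x + pd j (fun y => G y i l) x - pd l (fun y => G y i j) x)

/-- The Riemann tensor `R_{jkl}{}^m`, with the sign convention
`[∇_j, ∇_k] u_l = R_{jkl}{}^m u_m`; that is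
`R_{jkl}{}^m = ∂_k Γ^m_{jl} - ∂_j Γ^m_{kl} + Γ^m_{ks} Γ^s_{jl} - Γ^m_{js} Γ^s_{kl}`. -/
def localRiemann {n : ℕ} (G : Coord n → Matrix (Fin n) (Fin n) ℝ) (x : Coord n)
    (j k l m : Fin n) : ℝ :=
  pd k (christoffel G m j l) x - pd j (christoffel G m k l) x
    + ∑ s, (christoffel G m k s x * christoffel G s j l x
      - christoffel G m j s x * christoffel G s k l x)

/-! ### Pseudo-Riemannian manifolds -/

/-- A smooth pseudo-Riemannian metric, of arbitrary signature, on the manifold `M`: a smooth section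
of the bundle of bilinear forms on the tangent spaces, symmetric and nondegenerate at each point. -/
structure PseudoRiemannianMetric (n : ℕ) (M : Type*) [TopologicalSpace M]
    [ChartedSpace (Coord n) M] [IsManifold (𝓡 n) ∞ M] where
  val : ∀ p : M, TangentSpace (𝓡 n) p →L[ℝ] TangentSpace (𝓡 n) p →L[ℝ] ℝ
  symm : ∀ (p : M) (u v : TangentSpace (𝓡 n) p), val p u v = val p v u
  nondegenerate : ∀ (p : M) (u : TangentSpace (𝓡 n) p), (∀ v, val p u v = 0) → u = 0
  contMDiff : ContMDiff (𝓡 n) ((𝓡 n).prod 𝓘(ℝ, Coord n →L[ℝ] Coord n →L[ℝ] ℝ)) ∞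
    (fun p : M => Bundle.TotalSpace.mk' (Coord n →L[ℝ] Coord n →L[ℝ] ℝ) p (val p))

section Tensors

variable {n : ℕ} {M : Type*} [TopologicalSpace M] [ChartedSpace (Coord n) M]
  [IsManifold (𝓡 n) ∞ M]

/-- The coefficients `g(∂ᵢ, ∂ⱼ)` of the metric in the preferred chart `φ` at `p`, as a function on
the chart's image in `ℝⁿ`: the coordinate vector fields are `∂ᵢ = d(φ⁻¹)(eᵢ)`. -/
def PseudoRiemannianMetric.inChart (g : PseudoRiemannianMetric n M) (p : M) (x : Coord n) :
    Matrix (Fin n) (Fin n) ℝ :=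
  Matrix.of fun i j =>
    g.val ((extChartAt (𝓡 n) p).symm x)
      (mfderiv 𝓘(ℝ, Coord n) (𝓡 n) (extChartAt (𝓡 n) p).symm x (e i))
      (mfderiv 𝓘(ℝ, Coord n) (𝓡 n) (extChartAt (𝓡 n) p).symm x (e j))

/-! All components below are taken at the point `p`, in the coordinate frame of the preferred chart
at `p`. -/

/-- `g_{ij}`. -/
def metric (g : PseudoRiemannianMetric n M) (p : M) : Matrix (Fin n) (Fin n) ℝ :=
  Matrix.of fun i j => g.val p (e i) (e j)

/-- The components `u^i` of a tangent vector. -/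
def coords {p : M} (u : TangentSpace (𝓡 n) p) : Coord n := u

/-- `u_i = g_{ij} u^j`. -/
def lower (g : PseudoRiemannianMetric n M) (p : M) (u : TangentSpace (𝓡 n) p) (i : Fin n) : ℝ :=
  g.val p (e i) u

/-- The Christoffel symbol `Γᵏᵢⱼ` of the Levi-Civita connection. -/
def christoffelAt (g : PseudoRiemannianMetric n M) (p : M) (k i j : Fin n) : ℝ :=
  christoffel (g.inChart p) k i j (extChartAt (𝓡 n) p p)

/-- The Riemann tensor `R_{jkl}{}^m` of the Levi-Civita connection. -/
def riemann (g : PseudoRiemannianMetric n M) (p : M) (j k l m : Fin n) : ℝ :=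
  localRiemann (g.inChart p) (extChartAt (𝓡 n) p p) j k l m

/-- `R_{ab} = R_{amb}{}^m`. -/
def ricci (g : PseudoRiemannianMetric n M) (p : M) (a b : Fin n) : ℝ :=
  ∑ m, riemann g p a m b m

/-- The curvature scalar `R = g^{ab} R_{ab}`. -/
def scalar (g : PseudoRiemannianMetric n M) (p : M) : ℝ :=
  ∑ a, ∑ b, (metric g p)⁻¹ a b * ricci g p a b

/-- `R_a{}^m = R_{as} g^{sm}`. -/
def ricciUp (g : PseudoRiemannianMetric n M) (p : M) (a m : Fin n) : ℝ :=
  ∑ s, ricci g p a s * (metric g p)⁻¹ s m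

/-- The Kronecker symbol. -/
def δ {n : ℕ} (i j : Fin n) : ℝ := if i = j then 1 else 0

/-- The Weyl tensor `C_{jkl}{}^m` (for `n ≥ 3`). -/
def weyl (g : PseudoRiemannianMetric n M) (p : M) (j k l m : Fin n) : ℝ :=
  riemann g p j k l m
    + (1 / ((n : ℝ) - 2)) *
      (δ j m * ricci g p k l - δ k m * ricci g p j l
        + ricciUp g p j m * metric g p k l - ricciUp g p k m * metric g p j l)
    - scalar g p / (((n : ℝ) - 1) * ((n : ℝ) - 2)) *
      (δ j m * metric g p k l - δ k m * metric g p j l)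

/-- Lowering the last index of `K_{jkl}{}^m`. -/
def lowerLast (g : PseudoRiemannianMetric n M) (p : M) (K : Fin n → Fin n → Fin n → Fin n → ℝ)
    (j k l m : Fin n) : ℝ :=
  ∑ s, K j k l s * metric g p s m

/-- `(M, g)` is a space of constant curvature:
`R_{jklm} = κ (g_{jl} g_{km} - g_{jm} g_{kl})` with a constant `κ`. -/
def HasConstantCurvature (g : PseudoRiemannianMetric n M) : Prop :=
  ∃ κ : ℝ, ∀ (p : M) (j k l m : Fin n),
    lowerLast g p (riemann g p) j k l m =
      κ * (metric g p j l * metric g p k m - metric g p j m * metric g p k l)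

/-! ### Compatibility -/

/-- `b_{ij}` is symmetric and `K`-compatible:
`b_{am} K_{bcl}{}^m + b_{bm} K_{cal}{}^m + b_{cm} K_{abl}{}^m = 0`. -/
def TensorCompatible (K : Fin n → Fin n → Fin n → Fin n → ℝ) (b : Fin n → Fin n → ℝ) : Prop :=
  (∀ i j, b i j = b j i) ∧
  ∀ a b' c l, ∑ m, (b a m * K b' c l m + b b' m * K c a l m + b c m * K a b' l m) = 0

/-- The symmetric tensor `b` at `p` is Riemann compatible. -/
def RiemannCompatible (g : PseudoRiemannianMetric n M) (p : M) (b : Fin n → Fin n → ℝ) : Prop :=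
  TensorCompatible (riemann g p) b

/-- The symmetric tensor `b` at `p` is Weyl compatible. -/
def WeylCompatible (g : PseudoRiemannianMetric n M) (p : M) (b : Fin n → Fin n → ℝ) : Prop :=
  TensorCompatible (weyl g p) b

/-- The vector `u` at `p` is `K`-compatible:
`(u_i K_{jkl}{}^m + u_j K_{kil}{}^m + u_k K_{ijl}{}^m) u_m = 0`. -/
def VectorCompatible (g : PseudoRiemannianMetric n M) (p : M)
    (K : Fin n → Fin n → Fin n → Fin n → ℝ) (u : TangentSpace (𝓡 n) p) : Prop :=
  ∀ i j k l, ∑ m, (lower g p u i * K j k l m + lower g p u j * K k i l m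
    + lower g p u k * K i j l m) * lower g p u m = 0

/-- `u` is an eigenvector of `b` at `p` with eigenvalue `c`: `b_{km} u^m = c u_k`, `u ≠ 0`. -/
def IsEigenvector (g : PseudoRiemannianMetric n M) (p : M) (b : Fin n → Fin n → ℝ)
    (c : ℝ) (u : TangentSpace (𝓡 n) p) : Prop :=
  u ≠ 0 ∧ ∀ k, ∑ m, b k m * (coords u) m = c * lower g p u k

/-! ### Einstein's equations and the magnetic part of the Weyl tensor -/

/-- `T` is the energy-momentum tensor at `p`: `R_{ij} - (R/2) g_{ij} = 8π T_{ij}`. -/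
def EinsteinEquation (g : PseudoRiemannianMetric n M) (p : M) (T : Fin n → Fin n → ℝ) : Prop :=
  ∀ i j, ricci g p i j - scalar g p / 2 * metric g p i j = 8 * Real.pi * T i j

/-- `C(x, y, z, w) = C_{jklm} x^j y^k z^l w^m`. -/
def weylForm (g : PseudoRiemannianMetric n M) (p : M) (x y z w : TangentSpace (𝓡 n) p) : ℝ :=
  ∑ j, ∑ k, ∑ l, ∑ m, lowerLast g p (weyl g p) j k l m *
    (coords x) j * (coords y) k * (coords z) l *
    (coords w) m

/-- The Weyl tensor at `p` is purely electric with respect to the unit time-like vector `u`, in any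
dimension: its magnetic part, i.e. the components `C_{jklm} u^m` with the indices `j, k, l` projected
orthogonally to `u`, vanishes. -/
def WeylPurelyElectric (g : PseudoRiemannianMetric n M) (p : M) (u : TangentSpace (𝓡 n) p) : Prop :=
  ∀ x y z : TangentSpace (𝓡 n) p, g.val p x u = 0 → g.val p y u = 0 → g.val p z u = 0 →
    weylForm g p x y z u = 0

/-- In dimension four, the components `ε_{abrs}` of the volume form (of the chart's orientation):
`√|det g|` times the permutation symbol. -/
def volumeFour (h : n = 4) (g : PseudoRiemannianMetric n M) (p : M) (a b r s : Fin n) : ℝ :=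
  Real.sqrt |(metric g p).det| *
    (Matrix.of fun i k : Fin 4 => δ (![a, b, r, s] i) (Fin.cast h.symm k)).det

/-- In dimension four, the dual Weyl tensor `C̃_{abcd} = ½ ε_{abrs} C^{rs}{}_{cd}`. -/
def dualWeyl (h : n = 4) (g : PseudoRiemannianMetric n M) (p : M) (a b c d : Fin n) : ℝ :=
  (1 / 2) * ∑ r, ∑ s, volumeFour h g p a b r s *
    ∑ r', ∑ s', (metric g p)⁻¹ r r' * (metric g p)⁻¹ s s' *
      lowerLast g p (weyl g p) r' s' c d

/-- In dimension four, the magnetic tensor `H_{ab} = u^j u^m C̃_{jabm}`. -/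
def magneticWeyl (h : n = 4) (g : PseudoRiemannianMetric n M) (p : M) (u : TangentSpace (𝓡 n) p)
    (a b : Fin n) : ℝ :=
  ∑ j, ∑ m, (coords u) j * (coords u) m * dualWeyl h g p j a b m

end Tensors

/-! ### Hypersurfaces -/

section Hypersurface

variable {n : ℕ} {M : Type*} [TopologicalSpace M] [ChartedSpace (Coord n) M]
  [IsManifold (𝓡 n) ∞ M]
  {V : Type*} [TopologicalSpace V] [ChartedSpace (Coord (n + 1)) V]
  [IsManifold (𝓡 (n + 1)) ∞ V]

/-- `f : M → V` exhibits `(M, g)` as an isometrically immersed hypersurface of `(V, g')`: it is smooth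
and `g = f^* g'`. As `g` is nondegenerate, `f` is then an immersion; isometric embeddings are a
special case. -/
structure IsIsometricHypersurface (g : PseudoRiemannianMetric n M)
    (g' : PseudoRiemannianMetric (n + 1) V) (f : M → V) : Prop where
  smooth : ContMDiff (𝓡 n) (𝓡 (n + 1)) ∞ f
  isometric : ∀ (p : M) (u v : TangentSpace (𝓡 n) p),
    g.val p u v = g'.val (f p) (mfderiv (𝓡 n) (𝓡 (n + 1)) f p u)
      (mfderiv (𝓡 n) (𝓡 (n + 1)) f p v)

/-- `N` is a unit normal to the hypersurface at `p`: `g'(N, N) = ± 1` and `g'(B, N) = 0` for all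
tangent vectors `B`. -/
structure IsUnitNormal (g' : PseudoRiemannianMetric (n + 1) V) (f : M → V) (p : M)
    (N : TangentSpace (𝓡 (n + 1)) (f p)) : Prop where
  unit : g'.val (f p) N N = 1 ∨ g'.val (f p) N N = -1
  normal : ∀ u : TangentSpace (𝓡 n) p,
    g'.val (f p) (mfderiv (𝓡 n) (𝓡 (n + 1)) f p u) N = 0

/-- The map `f` in the preferred charts at `p` and at `f p`. -/
def localMap (f : M → V) (p : M) (x : Coord n) : Coord (n + 1) :=
  extChartAt (𝓡 (n + 1)) (f p) (f ((extChartAt (𝓡 n) p).symm x))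

/-- The second fundamental form at `p` with respect to the normal vector `N` at `f p`:
`Ω_{jl} = g'(∇'_{B_j} B_l, N)`, where `B_j = ∂_j F` are the coordinate tangent vectors and
`(∇'_{B_j} B_l)^μ = ∂_j ∂_l F^μ + Γ'^μ_{αβ} ∂_j F^α ∂_l F^β`. -/
def secondFundamentalForm (g' : PseudoRiemannianMetric (n + 1) V) (f : M → V) (p : M)
    (N : TangentSpace (𝓡 (n + 1)) (f p)) (j l : Fin n) : ℝ :=
  ∑ μ, lower g' (f p) N μ *
    (pd j (pd l fun x => localMap f p x μ) (extChartAt (𝓡 n) p p)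
      + ∑ α, ∑ β, christoffelAt g' (f p) μ α β *
        pd j (fun x => localMap f p x α) (extChartAt (𝓡 n) p p) *
        pd l (fun x => localMap f p x β) (extChartAt (𝓡 n) p p))

end Hypersurface

end

end WeylCompat

/-! Everything is algebra at one point once the Gauss equation is known. In a space of constant
curvature it reads `R_{jklm} = κ (g_{jl} g_{km} - g_{jm} g_{kl}) + ε (Ω_{jl} Ω_{km} - Ω_{jm}
Ω_{kl})` with `ε = g'(N,N) = ±1`. With the last index raised, the Riemann tensor is a combination of
terms `P_{jl} Q_k{}^m - Q_j{}^m P_{kl}` (`wedge P Q`) in which `Q` is the identity or `Ω` as an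
endomorphism. Its trace shows that Ricci is a quadratic polynomial in `Ω`, so the Weyl tensor has
the same shape, with the Ricci endomorphism as a further `Q`.

In the cyclic sum defining compatibility of `b` with `wedge P Q`, the terms cancel in pairs as soon
as `b_{im} Q_k{}^m` is symmetric in `i, k` (`tensorCompatible_wedge`), that is, when `b` and `Q`
commute as endomorphisms. Hence every symmetric `b` commuting with `Ω` is Riemann and Weyl
compatible: `Ω`, Ricci, `T` and `g` all qualify. The same cancellation works for a common
eigenvector of all the `Q` (`covectorCompatible_wedge`).

If `T = a u u + b g`, subtracting the compatible tensor `b g` leaves compatibility of `u`.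
Contracting that with `u` gives `C_{jkl}{}^m u_m = u_j X_{kl} + u_k Y_{jl}`, which vanishes on
vectors orthogonal to `u` and, when `n = 4`, is killed by the volume form.

The analytic input is the Gauss equation for maps between open sets of vector spaces
(`gauss_equation`), transferred to manifolds through the preferred charts. -/

namespace WeylCompat

noncomputable section

open Filter Topology

/-! ### The Gauss equation for connections on vector spaces -/

section Gauss

variable {X Y : Type*} [NormedAddCommGroup X] [NormedSpace ℝ X]
  [NormedAddCommGroup Y] [NormedSpace ℝ Y]

/-- The curvature `R(u, v) w` of the connection `d + Γ` on an open subset of a vector space. -/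
def curvature (Γ : X → X →L[ℝ] X →L[ℝ] X) (x u v w : X) : X :=
  fderiv ℝ Γ x v u w - fderiv ℝ Γ x u v w + Γ x v (Γ x u w) - Γ x u (Γ x v w)

/-- `Γ` is, at `x`, torsion-free and compatible with the field `h` of symmetric bilinear forms. -/
structure IsLeviCivitaAt (h : X → X →L[ℝ] X →L[ℝ] ℝ) (Γ : X → X →L[ℝ] X →L[ℝ] X) (x : X) :
    Prop where
  symm : ∀ u v, h x u v = h x v u
  torsionFree : ∀ u v, Γ x u v = Γ x v u
  differentiableAt : DifferentiableAt ℝ h x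
  fderiv_eq : ∀ w u v, fderiv ℝ h x w u v = h x (Γ x w u) v + h x u (Γ x w v)

/-- The second fundamental form of a map `F`, as a vector-valued form. -/
def vectorSecondForm (Γ : X → X →L[ℝ] X →L[ℝ] X) (Γ' : Y → Y →L[ℝ] Y →L[ℝ] Y) (F : X → Y)
    (u v x : X) : Y :=
  fderiv ℝ (fderiv ℝ F) x u v + Γ' (F x) (fderiv ℝ F x u) (fderiv ℝ F x v) - fderiv ℝ F x (Γ x u v)

variable {h : X → X →L[ℝ] X →L[ℝ] ℝ} {Γ : X → X →L[ℝ] X →L[ℝ] X}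
  {h' : Y → Y →L[ℝ] Y →L[ℝ] ℝ} {Γ' : Y → Y →L[ℝ] Y →L[ℝ] Y} {F : X → Y} {x : X}

/-- The Koszul argument: pairing the second form with tangent vectors gives a trilinear form
symmetric in its first two slots and skew in its last two, and such a form is zero. -/
theorem vectorSecondForm_normal (hΓ : IsLeviCivitaAt h Γ x) (hΓ' : IsLeviCivitaAt h' Γ' (F x))
    (hF : ContDiffAt ℝ 2 F x)
    (hiso : ∀ᶠ y in 𝓝 x, ∀ u v, h y u v = h' (F y) (fderiv ℝ F y u) (fderiv ℝ F y v)) (u v w : X) :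
    h' (F x) (vectorSecondForm Γ Γ' F u v x) (fderiv ℝ F x w) = 0 := by
  have hF1 : HasFDerivAt F (fderiv ℝ F x) x := (hF.differentiableAt (by norm_num)).hasFDerivAt
  have hF2 : HasFDerivAt (fderiv ℝ F) (fderiv ℝ (fderiv ℝ F) x) x :=
    ((hF.fderiv_right (m := 1) (by norm_num)).differentiableAt (by norm_num)).hasFDerivAt
  have hsymm : ∀ u v, fderiv ℝ (fderiv ℝ F) x u v = fderiv ℝ (fderiv ℝ F) x v u :=
    fun u v => (hF.isSymmSndFDerivAt (by simp)) u v
  have hx := hiso.self_of_nhds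
  -- Differentiate the isometry condition along `w` and substitute metric compatibility of both
  -- connections.
  have key : ∀ w u v, h' (F x) (vectorSecondForm Γ Γ' F w u x) (fderiv ℝ F x v)
      + h' (F x) (vectorSecondForm Γ Γ' F w v x) (fderiv ℝ F x u) = 0 := by
    intro w u v
    have e1 : (fun y => h y u v) =ᶠ[𝓝 x] fun y => h' (F y) (fderiv ℝ F y u) (fderiv ℝ F y v) :=
      hiso.mono fun y hy => hy u v
    have d1 : HasFDerivAt (fun y => h y u v) _ x :=
      (hΓ.differentiableAt.hasFDerivAt.clm_apply (hasFDerivAt_const u x)).clm_apply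
        (hasFDerivAt_const v x)
    have d2 : HasFDerivAt (fun y => h' (F y) (fderiv ℝ F y u) (fderiv ℝ F y v)) _ x :=
      ((hΓ'.differentiableAt.hasFDerivAt.comp x hF1).clm_apply
        (hF2.clm_apply (hasFDerivAt_const u x))).clm_apply (hF2.clm_apply (hasFDerivAt_const v x))
    have e2 := congrArg (fun L => L w) (d1.unique (d2.congr_of_eventuallyEq e1))
    simp [hΓ.fderiv_eq, hΓ'.fderiv_eq] at e2
    simp only [vectorSecondForm, map_add, map_sub, add_apply, sub_apply]
    rw [hx, hx] at e2
    rw [hΓ'.symm _ (fderiv ℝ F x u), hΓ'.symm _ (fderiv ℝ F x u), hΓ'.symm _ (fderiv ℝ F x u)]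
    linarith
  have esymm : ∀ u v, vectorSecondForm Γ Γ' F u v x = vectorSecondForm Γ Γ' F v u x := by
    intro u v
    simp only [vectorSecondForm]
    rw [hsymm u v, hΓ.torsionFree u v, hΓ'.torsionFree]
  have k1 := key u v w
  have k2 := key v w u
  have k3 := key w u v
  rw [esymm v u] at k2
  rw [esymm w u, esymm w v] at k3
  linarith

/-- The explicit value of the derivative makes the third derivatives of `F` visible, so that they
can cancel under antisymmetrisation. -/
theorem hasFDerivAt_vectorSecondForm (hΓ : DifferentiableAt ℝ Γ x)
    (hΓ' : DifferentiableAt ℝ Γ' (F x)) (hF : ContDiffAt ℝ 3 F x) (u v : X) :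
    ∃ L : X →L[ℝ] Y, HasFDerivAt (vectorSecondForm Γ Γ' F u v) L x ∧ ∀ z, L z =
      fderiv ℝ (fderiv ℝ (fderiv ℝ F)) x z u v
      + (fderiv ℝ Γ' (F x) (fderiv ℝ F x z) (fderiv ℝ F x u) (fderiv ℝ F x v)
        + Γ' (F x) (fderiv ℝ (fderiv ℝ F) x z u) (fderiv ℝ F x v)
        + Γ' (F x) (fderiv ℝ F x u) (fderiv ℝ (fderiv ℝ F) x z v))
      - (fderiv ℝ (fderiv ℝ F) x z (Γ x u v) + fderiv ℝ F x (fderiv ℝ Γ x z u v)) := by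
  have hF1 : HasFDerivAt F (fderiv ℝ F x) x := (hF.differentiableAt (by norm_num)).hasFDerivAt
  have c2 : ContDiffAt ℝ 2 (fderiv ℝ F) x := hF.fderiv_right (m := 2) (by norm_num)
  have hF2 : HasFDerivAt (fderiv ℝ F) (fderiv ℝ (fderiv ℝ F) x) x :=
    (c2.differentiableAt (by norm_num)).hasFDerivAt
  have hF3 : HasFDerivAt (fderiv ℝ (fderiv ℝ F)) (fderiv ℝ (fderiv ℝ (fderiv ℝ F)) x) x :=
    ((c2.fderiv_right (m := 1) (by norm_num)).differentiableAt (by norm_num)).hasFDerivAt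
  have cu := hasFDerivAt_const (𝕜 := ℝ) u x
  have cv := hasFDerivAt_const (𝕜 := ℝ) v x
  have d : HasFDerivAt (vectorSecondForm Γ Γ' F u v) _ x :=
    (((hF3.clm_apply cu).clm_apply cv).add
      (((hΓ'.hasFDerivAt.comp x hF1).clm_apply (hF2.clm_apply cu)).clm_apply
        (hF2.clm_apply cv))).sub
      (hF2.clm_apply ((hΓ.hasFDerivAt.clm_apply cu).clm_apply cv))
  refine ⟨_, d, fun z => ?_⟩
  simp
  abel

/-- The Gauss equation. -/
theorem gauss_equation (hΓ : ∀ᶠ y in 𝓝 x, IsLeviCivitaAt h Γ y)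
    (hΓ' : ∀ᶠ y in 𝓝 (F x), IsLeviCivitaAt h' Γ' y)
    (hdΓ : DifferentiableAt ℝ Γ x) (hdΓ' : DifferentiableAt ℝ Γ' (F x)) (hF : ContDiffAt ℝ 3 F x)
    (hiso : ∀ᶠ y in 𝓝 x, ∀ u v, h y u v = h' (F y) (fderiv ℝ F y u) (fderiv ℝ F y v))
    (u v w z : X) :
    h x (curvature Γ x u v w) z =
      h' (F x) (curvature Γ' (F x) (fderiv ℝ F x u) (fderiv ℝ F x v) (fderiv ℝ F x w))
        (fderiv ℝ F x z)
      + h' (F x) (vectorSecondForm Γ Γ' F u w x) (vectorSecondForm Γ Γ' F v z x)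
      - h' (F x) (vectorSecondForm Γ Γ' F v w x) (vectorSecondForm Γ Γ' F u z x) := by
  have hF1 : HasFDerivAt F (fderiv ℝ F x) x := (hF.differentiableAt (by norm_num)).hasFDerivAt
  have c2 : ContDiffAt ℝ 2 (fderiv ℝ F) x := hF.fderiv_right (m := 2) (by norm_num)
  have hF2 : HasFDerivAt (fderiv ℝ F) (fderiv ℝ (fderiv ℝ F) x) x :=
    (c2.differentiableAt (by norm_num)).hasFDerivAt
  have hsymm : ∀ u v, fderiv ℝ (fderiv ℝ F) x u v = fderiv ℝ (fderiv ℝ F) x v u :=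
    fun u v => ((hF.of_le (by norm_num) : ContDiffAt ℝ 2 F x).isSymmSndFDerivAt (by simp)) u v
  have hsymm3 : ∀ u v, fderiv ℝ (fderiv ℝ (fderiv ℝ F)) x u v
      = fderiv ℝ (fderiv ℝ (fderiv ℝ F)) x v u :=
    fun u v => (c2.isSymmSndFDerivAt (by simp)) u v
  -- Normality is needed on a neighbourhood because it is differentiated below.
  have hnormal : ∀ᶠ y in 𝓝 x, ∀ u v w,
      h' (F y) (vectorSecondForm Γ Γ' F u v y) (fderiv ℝ F y w) = 0 := by
    filter_upwards [hΓ, hF1.continuousAt.eventually hΓ', hiso.eventually_nhds,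
      (hF.of_le (by norm_num) : ContDiffAt ℝ 2 F x).eventually (by simp)] with y h1 h2 h3 h4 u v w
    exact vectorSecondForm_normal h1 h2 h4 h3 u v w
  have hn := hnormal.self_of_nhds
  have hx := hΓ.self_of_nhds
  have hx' := hΓ'.self_of_nhds
  -- Derivative along `z` of the orthogonality relation: the tangential component of the covariant
  -- derivative of the second form is minus a product of second forms. The term `Γ x z w` may be
  -- inserted freely, since its image under the derivative of `F` is tangent.
  have step : ∀ z u v w, ∀ L : X →L[ℝ] Y, HasFDerivAt (vectorSecondForm Γ Γ' F u v) L x →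
      h' (F x) (L z + Γ' (F x) (fderiv ℝ F x z) (vectorSecondForm Γ Γ' F u v x)) (fderiv ℝ F x w)
        = - h' (F x) (vectorSecondForm Γ Γ' F u v x) (vectorSecondForm Γ Γ' F z w x) := by
    intro z u v w L hL
    have d : HasFDerivAt (fun y => h' (F y) (vectorSecondForm Γ Γ' F u v y) (fderiv ℝ F y w)) _ x :=
      ((hx'.differentiableAt.hasFDerivAt.comp x hF1).clm_apply hL).clm_apply
        (hF2.clm_apply (hasFDerivAt_const w x))
    have e1 : (fun y => h' (F y) (vectorSecondForm Γ Γ' F u v y) (fderiv ℝ F y w))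
        =ᶠ[𝓝 x] fun _ => (0 : ℝ) := hnormal.mono fun y hy => hy u v w
    have e2 := congrArg (fun L => L z)
      (d.unique ((hasFDerivAt_const (0 : ℝ) x).congr_of_eventuallyEq e1))
    simp [hx'.fderiv_eq] at e2
    have e3 := hn u v (Γ x z w)
    have e4 : vectorSecondForm Γ Γ' F z w x = fderiv ℝ (fderiv ℝ F) x z w
      + Γ' (F x) (fderiv ℝ F x z) (fderiv ℝ F x w) - fderiv ℝ F x (Γ x z w) := rfl
    rw [e4, map_sub, map_add, map_add, add_apply]
    linarith
  obtain ⟨L1, hL1, e1⟩ := hasFDerivAt_vectorSecondForm hdΓ hdΓ' hF u w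
  obtain ⟨L2, hL2, e2⟩ := hasFDerivAt_vectorSecondForm hdΓ hdΓ' hF v w
  have s1 := step v u w z L1 hL1
  have s2 := step u v w z L2 hL2
  -- Antisymmetrising in `u, v` removes the third derivatives and leaves the difference of the two
  -- curvatures, up to values of the second form, which are normal and vanish when paired with a
  -- tangent vector.
  have main : (L1 v + Γ' (F x) (fderiv ℝ F x v) (vectorSecondForm Γ Γ' F u w x))
      - (L2 u + Γ' (F x) (fderiv ℝ F x u) (vectorSecondForm Γ Γ' F v w x))
      = curvature Γ' (F x) (fderiv ℝ F x u) (fderiv ℝ F x v) (fderiv ℝ F x w)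
        - fderiv ℝ F x (curvature Γ x u v w)
        - vectorSecondForm Γ Γ' F v (Γ x u w) x + vectorSecondForm Γ Γ' F u (Γ x v w) x := by
    rw [e1, e2, hsymm3 v u, hsymm v u]
    simp only [vectorSecondForm, curvature, map_add, map_sub]
    abel
  have e5 := congrArg (fun y => h' (F x) y (fderiv ℝ F x z)) main
  simp only [map_sub, map_add, sub_apply, add_apply, hn] at e5 s1 s2
  rw [hiso.self_of_nhds]
  linarith

end Gauss

/-! ### Christoffel symbols as the Levi-Civita connection of a matrix of coefficients -/

section Coordinates

variable {n : ℕ} {W : Type*} [NormedAddCommGroup W] [NormedSpace ℝ W]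

theorem e_apply (i j : Fin n) : (e i : Coord n) j = if j = i then 1 else 0 := by
  simp [e]

theorem sum_smul_e (u : Coord n) : ∑ i, u i • (e i : Coord n) = u := by
  ext j
  simp [e_apply]

/-- Unbundled linearity lets multilinear identities be reduced to the coordinate frame one slot at a
time. -/
theorem IsLinearMap.eq_of_e {f f' : Coord n → W} (hf : IsLinearMap ℝ f) (hf' : IsLinearMap ℝ f')
    (h : ∀ i, f (e i) = f' (e i)) (u : Coord n) : f u = f' u := by
  have h1 : hf.mk' f u = hf'.mk' f' u := by
    rw [← sum_smul_e u, map_sum, map_sum]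
    refine Finset.sum_congr rfl fun i _ => ?_
    rw [map_smul, map_smul]
    exact congrArg _ (h i)
  exact h1

/-- The continuous bilinear map with given values on pairs of coordinate vectors. -/
def bilin (c : Fin n → Fin n → W) : Coord n →L[ℝ] Coord n →L[ℝ] W :=
  ∑ i, ∑ j, (EuclideanSpace.proj i : Coord n →L[ℝ] ℝ).smulRight
    ((EuclideanSpace.proj j : Coord n →L[ℝ] ℝ).smulRight (c i j))

theorem bilin_apply (c : Fin n → Fin n → W) (u v : Coord n) :
    bilin c u v = ∑ i, ∑ j, u i • v j • c i j := by
  simp [bilin]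

@[simp] theorem bilin_e (c : Fin n → Fin n → W) (i j : Fin n) : bilin c (e i) (e j) = c i j := by
  simp [bilin_apply, e_apply]

theorem bilin_of_apply_e (B : Coord n →L[ℝ] Coord n →L[ℝ] W) :
    bilin (fun i j => B (e i) (e j)) = B := by
  ext u v
  conv_rhs => rw [← sum_smul_e u, ← sum_smul_e v]
  simp only [bilin_apply, map_sum, map_smul, sum_apply, smul_apply, Finset.smul_sum]
  rw [Finset.sum_comm]
  exact Finset.sum_congr rfl fun i _ => Finset.sum_congr rfl fun j _ => smul_comm _ _ _

theorem _root_.ContDiffAt.bilin {E : Type*} [NormedAddCommGroup E] [NormedSpace ℝ E] {k : ℕ∞ω}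
    {c : E → Fin n → Fin n → W} {x : E} (hc : ∀ i j, ContDiffAt ℝ k (fun y => c y i j) x) :
    ContDiffAt ℝ k (fun y => bilin (c y)) x := by
  unfold WeylCompat.bilin
  exact ContDiffAt.sum fun i _ => ContDiffAt.sum fun j _ =>
    contDiffAt_const.smulRight (contDiffAt_const.smulRight (hc i j))

theorem fderiv_bilin {E : Type*} [NormedAddCommGroup E] [NormedSpace ℝ E]
    {c : E → Fin n → Fin n → W} {x : E} (hc : DifferentiableAt ℝ (fun y => bilin (c y)) x) (w : E)
    (i j : Fin n) :
    fderiv ℝ (fun y => bilin (c y)) x w (e i) (e j) = fderiv ℝ (fun y => c y i j) x w := by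
  have h := ((hc.hasFDerivAt.clm_apply (hasFDerivAt_const (e i) x)).clm_apply
    (hasFDerivAt_const (e j) x)).fderiv
  simp only [bilin_e] at h
  rw [h]
  simp

theorem _root_.ContDiffAt.matrix_det {E : Type*} [NormedAddCommGroup E] [NormedSpace ℝ E] {k : ℕ∞ω}
    {G : E → Matrix (Fin n) (Fin n) ℝ} {x : E} (hG : ∀ i j, ContDiffAt ℝ k (fun y => G y i j) x) :
    ContDiffAt ℝ k (fun y => (G y).det) x := by
  simp only [Matrix.det_apply']
  exact ContDiffAt.sum fun s _ => contDiffAt_const.mul (contDiffAt_prod fun i _ => hG _ _)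

/-- Cramer's rule: an entry of the inverse is a quotient of determinants, the numerator having one
row replaced by a constant one. -/
theorem _root_.ContDiffAt.matrix_inv {E : Type*} [NormedAddCommGroup E] [NormedSpace ℝ E] {k : ℕ∞ω}
    {G : E → Matrix (Fin n) (Fin n) ℝ} {x : E} (hG : ∀ i j, ContDiffAt ℝ k (fun y => G y i j) x)
    (hdet : (G x).det ≠ 0) (i j : Fin n) :
    ContDiffAt ℝ k (fun y => (G y)⁻¹ i j) x := by
  simp only [Matrix.inv_def, Matrix.smul_apply, Ring.inverse_eq_inv', Matrix.adjugate_apply,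
    smul_eq_mul]
  refine ((ContDiffAt.matrix_det hG).inv hdet).mul (ContDiffAt.matrix_det fun a b => ?_)
  by_cases ha : a = j
  · simp only [Matrix.updateRow_apply, ha, if_true]
    exact contDiffAt_const
  · simp only [Matrix.updateRow_apply, ha, if_false]
    exact hG a b

/-- The Christoffel symbols as a field of bilinear maps. -/
def connectionForm (G : Coord n → Matrix (Fin n) (Fin n) ℝ) (x : Coord n) :
    Coord n →L[ℝ] Coord n →L[ℝ] Coord n :=
  bilin fun i j => WithLp.toLp 2 fun k => christoffel G k i j x

variable {G : Coord n → Matrix (Fin n) (Fin n) ℝ} {x : Coord n}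

theorem contDiffAt_christoffel (hG : ∀ i j, ContDiffAt ℝ 2 (fun y => G y i j) x)
    (hdet : (G x).det ≠ 0) (k i j : Fin n) : ContDiffAt ℝ 1 (christoffel G k i j) x := by
  have hpd : ∀ l i j, ContDiffAt ℝ 1 (pd l fun y => G y i j) x := fun l i j =>
    ((hG i j).fderiv_right (m := 1) (by norm_num)).clm_apply contDiffAt_const
  have hinv : ∀ i j, ContDiffAt ℝ 1 (fun y => (G y)⁻¹ i j) x :=
    ContDiffAt.matrix_inv (fun i j => (hG i j).of_le (by norm_num)) hdet
  unfold christoffel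
  exact contDiffAt_const.mul (ContDiffAt.sum fun l _ =>
    (hinv k l).mul (((hpd _ _ _).add (hpd _ _ _)).sub (hpd _ _ _)))

theorem differentiableAt_connectionForm (hG : ∀ i j, ContDiffAt ℝ 2 (fun y => G y i j) x)
    (hdet : (G x).det ≠ 0) : DifferentiableAt ℝ (connectionForm G) x := by
  refine (ContDiffAt.bilin (k := 1) fun i j => ?_).differentiableAt (by norm_num)
  exact contDiffAt_euclidean.2 fun k => contDiffAt_christoffel hG hdet k i j

theorem isLeviCivitaAt_connectionForm
    (hsymm : ∀ i j, (fun y => G y i j) = fun y => G y j i) (hdet : (G x).det ≠ 0)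
    (hd : DifferentiableAt ℝ (fun y => bilin fun i j => G y i j) x) :
    IsLeviCivitaAt (fun y => bilin fun i j => G y i j) (connectionForm G) x := by
  have hs : ∀ i j, G x i j = G x j i := fun i j => congrFun (hsymm i j) x
  -- Lowering the upper index cancels the inverse metric and gives the symbols of the first kind.
  -- Metric compatibility then follows because two of them add up to `∂_a g_{bc}`.
  have hlow : ∀ i j l, ∑ k, christoffel G k i j x * G x k l =
      1 / 2 * (pd i (fun y => G y j l) x + pd j (fun y => G y i l) x - pd l (fun y => G y i j) x) := by
    intro i j l
    have hinv : ∀ a b, ∑ k, G x a k * (G x)⁻¹ k b = if a = b then 1 else 0 := fun a b => by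
      rw [← Matrix.mul_apply, Matrix.mul_nonsing_inv _ (isUnit_iff_ne_zero.2 hdet),
        Matrix.one_apply]
    simp only [christoffel, Finset.mul_sum, Finset.sum_mul]
    rw [Finset.sum_comm]
    have : ∀ s k, 1 / 2 * ((G x)⁻¹ k s * (pd i (fun y => G y j s) x + pd j (fun y => G y i s) x
        - pd s (fun y => G y i j) x)) * G x k l = (G x l k * (G x)⁻¹ k s) *
        (1 / 2 * (pd i (fun y => G y j s) x + pd j (fun y => G y i s) x
        - pd s (fun y => G y i j) x)) := by
      intro s k
      rw [hs l k]; ring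
    simp only [this, ← Finset.sum_mul, hinv]
    simp
  refine ⟨fun u v => ?_, fun u v => ?_, hd, fun w u v => ?_⟩
  · rw [bilin_apply, bilin_apply, Finset.sum_comm]
    refine Finset.sum_congr rfl fun i _ => Finset.sum_congr rfl fun j _ => ?_
    rw [hs, smul_comm]
  · simp only [connectionForm, bilin_apply]
    rw [Finset.sum_comm]
    refine Finset.sum_congr rfl fun i _ => Finset.sum_congr rfl fun j _ => ?_
    rw [smul_comm]
    congr 3
    ext k
    simp only [christoffel]
    refine congrArg _ (Finset.sum_congr rfl fun l _ => ?_)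
    rw [hsymm i j]
    ring
  · refine IsLinearMap.eq_of_e (f := fun w => fderiv ℝ (fun y => bilin fun i j => G y i j) x w u v)
      (f' := fun w => bilin (fun i j => G x i j) (connectionForm G x w u) v
        + bilin (fun i j => G x i j) u (connectionForm G x w v))
      ⟨by simp, by simp⟩ ⟨fun _ _ => by simp; ring, fun _ _ => by simp; ring⟩ (fun a => ?_) w
    refine IsLinearMap.eq_of_e (f := fun u => fderiv ℝ (fun y => bilin fun i j => G y i j) x (e a) u v)
      (f' := fun u => bilin (fun i j => G x i j) (connectionForm G x (e a) u) v
        + bilin (fun i j => G x i j) u (connectionForm G x (e a) v))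
      ⟨by simp, by simp⟩ ⟨fun _ _ => by simp; ring, fun _ _ => by simp; ring⟩ (fun b => ?_) u
    refine IsLinearMap.eq_of_e (f := fun v => fderiv ℝ (fun y => bilin fun i j => G y i j) x (e a) (e b) v)
      (f' := fun v => bilin (fun i j => G x i j) (connectionForm G x (e a) (e b)) v
        + bilin (fun i j => G x i j) (e b) (connectionForm G x (e a) v))
      ⟨by simp, by simp⟩ ⟨fun _ _ => by simp; ring, fun _ _ => by simp; ring⟩ (fun c => ?_) v
    rw [fderiv_bilin hd]
    simp only [connectionForm, bilin_e]
    have h1 := hlow a b c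
    have h2 := hlow a c b
    simp only [bilin_apply, e_apply]
    simp [hs b] at h1 h2 ⊢
    rw [h1, h2]
    change pd a (fun y => G y b c) x = _
    rw [hsymm c b]
    ring

theorem curvature_connectionForm_e (hd : DifferentiableAt ℝ (connectionForm G) x)
    (j k l m : Fin n) :
    curvature (connectionForm G) x (e j) (e k) (e l) m = localRiemann G x j k l m := by
  have hcomp : ∀ a i j, fderiv ℝ (connectionForm G) x (e a) (e i) (e j) m
      = pd a (christoffel G m i j) x := by
    intro a i j
    have h := ((hd.hasFDerivAt.clm_apply (hasFDerivAt_const (e i) x)).clm_apply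
      (hasFDerivAt_const (e j) x))
    have h2 := ((EuclideanSpace.proj m : Coord n →L[ℝ] ℝ).hasFDerivAt.comp x h).fderiv
    have h3 : ((EuclideanSpace.proj m : Coord n →L[ℝ] ℝ) ∘ fun y => connectionForm G y (e i) (e j))
        = christoffel G m i j := by
      ext y; simp [connectionForm]
    rw [h3] at h2
    rw [pd, h2]
    simp
  have hquad : ∀ a u, connectionForm G x (e a) u m = ∑ s, christoffel G m a s x * u s := by
    intro a u
    simp [connectionForm, bilin_apply, e_apply, mul_comm]
  simp only [curvature, PiLp.add_apply, PiLp.sub_apply, hcomp, hquad, localRiemann,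
    Finset.sum_sub_distrib]
  simp only [connectionForm, bilin_e]
  ring

end Coordinates

/-! ### The metric in the preferred chart -/

section Charts

variable {n : ℕ} {M : Type*} [TopologicalSpace M] [ChartedSpace (Coord n) M]
  [IsManifold (𝓡 n) ∞ M]

theorem contMDiffAt_extChartAt_symm {p : M} {x : Coord n} (hx : x ∈ (extChartAt (𝓡 n) p).target) :
    ContMDiffAt 𝓘(ℝ, Coord n) (𝓡 n) ∞ (extChartAt (𝓡 n) p).symm x :=
  (contMDiffOn_extChartAt_symm p).contMDiffAt ((isOpen_extChartAt_target p).mem_nhds hx)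

/-- The coordinate fields are images of constant fields under the tangent map of the inverse chart,
hence smooth, and a smooth bundle metric evaluated on smooth fields is smooth. -/
theorem contDiffAt_val_mfderiv (g : PseudoRiemannianMetric n M) {p : M} {x : Coord n}
    (hx : x ∈ (extChartAt (𝓡 n) p).target) (u v : Coord n) :
    ContDiffAt ℝ ∞ (fun y => g.val ((extChartAt (𝓡 n) p).symm y)
      (mfderiv 𝓘(ℝ, Coord n) (𝓡 n) (extChartAt (𝓡 n) p).symm y u)
      (mfderiv 𝓘(ℝ, Coord n) (𝓡 n) (extChartAt (𝓡 n) p).symm y v)) x := by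
  have hs : UniqueMDiffOn 𝓘(ℝ, Coord n) (extChartAt (𝓡 n) p).target :=
    (isOpen_extChartAt_target p).uniqueMDiffOn
  have hfield : ∀ w : Coord n, ContMDiffAt 𝓘(ℝ, Coord n) ((𝓡 n).prod 𝓘(ℝ, Coord n)) ∞
      (fun y => Bundle.TotalSpace.mk' (Coord n) (E := fun q : M => TangentSpace (𝓡 n) q)
        ((extChartAt (𝓡 n) p).symm y)
        (mfderiv 𝓘(ℝ, Coord n) (𝓡 n) (extChartAt (𝓡 n) p).symm y w)) x := by
    intro w
    have h1 := (contMDiffOn_extChartAt_symm (I := 𝓡 n) (n := ∞) p).contMDiffOn_tangentMapWithin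
      (m := ∞) (by simp) hs
    have h2 : ContMDiff 𝓘(ℝ, Coord n) (𝓘(ℝ, Coord n).prod 𝓘(ℝ, Coord n)) ∞
      (fun y : Coord n => Bundle.TotalSpace.mk' (Coord n)
        (E := fun q : Coord n => TangentSpace 𝓘(ℝ, Coord n) q) y w) := by
      intro y
      exact contMDiffAt_vectorSpace_iff_contDiffAt.2 contDiffAt_const
    have h3 := h1.comp (s := (extChartAt (𝓡 n) p).target) h2.contMDiffOn (fun y hy => hy)
    refine ((h3 x hx).contMDiffAt ((isOpen_extChartAt_target p).mem_nhds hx)).congr_of_eventuallyEq ?_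
    filter_upwards [(isOpen_extChartAt_target p).mem_nhds hx] with y hy
    simp only [Function.comp, tangentMapWithin]
    rw [mfderivWithin_of_isOpen (isOpen_extChartAt_target p) hy]
  have hval := (g.contMDiff.contMDiffAt (x := (extChartAt (𝓡 n) p).symm x)).comp x
    (contMDiffAt_extChartAt_symm hx)
  have : ContMDiffAt 𝓘(ℝ, Coord n) ((𝓡 n).prod 𝓘(ℝ)) ∞
      (fun y ↦ Bundle.TotalSpace.mk' ℝ (E := Bundle.Trivial M ℝ) ((extChartAt (𝓡 n) p).symm y)
      (g.val ((extChartAt (𝓡 n) p).symm y)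
      (mfderiv 𝓘(ℝ, Coord n) (𝓡 n) (extChartAt (𝓡 n) p).symm y u)
      (mfderiv 𝓘(ℝ, Coord n) (𝓡 n) (extChartAt (𝓡 n) p).symm y v))) x := by
    apply ContMDiffAt.clm_bundle_apply₂ (F₁ := Coord n) (F₂ := Coord n)
    · exact hval
    · exact hfield u
    · exact hfield v
  exact (Bundle.contMDiffAt_totalSpace.1 this).2.contDiffAt

theorem mfderiv_extChartAt_symm_self (p : M) :
    mfderiv 𝓘(ℝ, Coord n) (𝓡 n) (extChartAt (𝓡 n) p).symm (extChartAt (𝓡 n) p p)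
      = ContinuousLinearMap.id ℝ (Coord n) := by
  have h := mfderivWithin_range_extChartAt_symm (I := 𝓡 n) (x := p)
  have hr : Set.range (𝓡 n) = Set.univ := by simp
  rw [hr, mfderivWithin_univ] at h
  exact h

theorem PseudoRiemannianMetric.val_congr (g : PseudoRiemannianMetric n M) {q q' : M} (h : q = q')
    (u v : Coord n) :
    g.val q (u : TangentSpace (𝓡 n) q) (v : TangentSpace (𝓡 n) q)
      = g.val q' (u : TangentSpace (𝓡 n) q') (v : TangentSpace (𝓡 n) q') := by
  subst h; rfl

theorem PseudoRiemannianMetric.inChart_self (g : PseudoRiemannianMetric n M) (p : M) :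
    g.inChart p (extChartAt (𝓡 n) p p) = metric g p := by
  ext i j
  simp only [inChart, metric, Matrix.of_apply]
  rw [mfderiv_extChartAt_symm_self]
  exact g.val_congr (extChartAt_to_inv p) _ _

end Charts

/-! ### The immersion in charts -/

section LocalMap
variable {n : ℕ} {M : Type*} [TopologicalSpace M] [ChartedSpace (Coord n) M]
  {V : Type*} [TopologicalSpace V] [ChartedSpace (Coord (n + 1)) V]

theorem localMap_self (f : M → V) (p : M) :
   localMap f p (extChartAt (𝓡 n) p p) = extChartAt (𝓡 (n + 1)) (f p) (f p) := by
  rw [localMap, extChartAt_to_inv]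

theorem eventually_chart_mem {f : M → V} (hf : ContMDiff (𝓡 n) (𝓡 (n + 1)) ∞ f) (p : M) :
    ∀ᶠ x in 𝓝 (extChartAt (𝓡 n) p p), x ∈ (extChartAt (𝓡 n) p).target ∧
      f ((extChartAt (𝓡 n) p).symm x) ∈ (extChartAt (𝓡 (n + 1)) (f p)).source := by
  refine Filter.Eventually.and (extChartAt_target_mem_nhds p) ?_
  have h1 : ContinuousAt (fun x => f ((extChartAt (𝓡 n) p).symm x)) (extChartAt (𝓡 n) p p) :=
    hf.continuous.continuousAt.comp (continuousAt_extChartAt_symm p)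
  apply h1.preimage_mem_nhds
  rw [extChartAt_to_inv]
  exact extChartAt_source_mem_nhds (f p)

/-- The derivative of `f` at `p` in the preferred charts. -/
def localDeriv (f : M → V) (p : M) : Coord n →L[ℝ] Coord (n + 1) :=
  fderiv ℝ (localMap f p) (extChartAt (𝓡 n) p p)

theorem mfderiv_eq_localDeriv {f : M → V} (hf : ContMDiff (𝓡 n) (𝓡 (n + 1)) ∞ f) (p : M) :
    mfderiv (𝓡 n) (𝓡 (n + 1)) f p = localDeriv f p := by
  have h1 : MDifferentiableAt (𝓡 n) (𝓡 (n + 1)) f p := hf.mdifferentiable (by simp) p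
  have hr : Set.range (𝓡 n) = Set.univ := by simp
  rw [h1.mfderiv, hr, fderivWithin_univ]
  rfl

variable [IsManifold (𝓡 n) ∞ M] [IsManifold (𝓡 (n + 1)) ∞ V]

theorem contDiffAt_localMap {f : M → V} (hf : ContMDiff (𝓡 n) (𝓡 (n + 1)) ∞ f) (p : M) :
    ContDiffAt ℝ ∞ (localMap f p) (extChartAt (𝓡 n) p p) := by
  rw [← contMDiffAt_iff_contDiffAt]
  have hx := (eventually_chart_mem hf p).self_of_nhds
  have h1 := contMDiffAt_extChartAt' (I := 𝓡 (n + 1)) (n := ∞) (x := f p)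
    (by simpa only [extChartAt_source] using hx.2)
  have h2 : ContMDiffAt 𝓘(ℝ, Coord n) (𝓡 (n + 1)) ∞ (fun x => f ((extChartAt (𝓡 n) p).symm x))
      (extChartAt (𝓡 n) p p) :=
    ContMDiffAt.comp (g := f) _ hf.contMDiffAt (contMDiffAt_extChartAt_symm hx.1)
  exact ContMDiffAt.comp (g := extChartAt (𝓡 (n + 1)) (f p)) _ h1 h2

theorem val_comp_chart {f : M → V} (hf : ContMDiff (𝓡 n) (𝓡 (n + 1)) ∞ f)
    (g' : PseudoRiemannianMetric (n + 1) V) (p : M) :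
    ∀ᶠ x in 𝓝 (extChartAt (𝓡 n) p p), ∀ u v : Coord n,
      g'.val (f ((extChartAt (𝓡 n) p).symm x))
        (mfderiv (𝓡 n) (𝓡 (n + 1)) f ((extChartAt (𝓡 n) p).symm x)
          (mfderiv 𝓘(ℝ, Coord n) (𝓡 n) (extChartAt (𝓡 n) p).symm x u))
        (mfderiv (𝓡 n) (𝓡 (n + 1)) f ((extChartAt (𝓡 n) p).symm x)
          (mfderiv 𝓘(ℝ, Coord n) (𝓡 n) (extChartAt (𝓡 n) p).symm x v)) =
      g'.val ((extChartAt (𝓡 (n + 1)) (f p)).symm (localMap f p x))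
        (mfderiv 𝓘(ℝ, Coord (n + 1)) (𝓡 (n + 1)) (extChartAt (𝓡 (n + 1)) (f p)).symm (localMap f p x)
          (fderiv ℝ (localMap f p) x u))
        (mfderiv 𝓘(ℝ, Coord (n + 1)) (𝓡 (n + 1)) (extChartAt (𝓡 (n + 1)) (f p)).symm (localMap f p x)
          (fderiv ℝ (localMap f p) x v)) := by
  have hne : (∞ : ℕ∞ω) ≠ 0 := by simp
  filter_upwards [(eventually_chart_mem hf p).eventually_nhds,
    ((contDiffAt_localMap hf p).of_le (m := 1) (by simp)).eventually (by simp)] with x hx hF u v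
  have hx0 := hx.self_of_nhds
  -- Near `x` both sides of the claim come from one map, factored through `M` or through the chart
  -- of `V`; the chain rule on each factorisation gives the result.
  have hEq : f ∘ (extChartAt (𝓡 n) p).symm =ᶠ[𝓝 x]
      (extChartAt (𝓡 (n + 1)) (f p)).symm ∘ localMap f p := by
    filter_upwards [hx] with y hy
    simp only [Function.comp, localMap]
    rw [(extChartAt (𝓡 (n + 1)) (f p)).left_inv hy.2]
  have htarget : localMap f p x ∈ (extChartAt (𝓡 (n + 1)) (f p)).target :=
    (extChartAt (𝓡 (n + 1)) (f p)).map_source hx0.2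
  have d1 := mfderiv_comp x (hf.mdifferentiable hne _)
    ((contMDiffAt_extChartAt_symm hx0.1).mdifferentiableAt hne)
  have d2 := mfderiv_comp x ((contMDiffAt_extChartAt_symm htarget).mdifferentiableAt hne)
    (hF.differentiableAt (by norm_num)).mdifferentiableAt
  have d3 := hEq.mfderiv_eq (I := 𝓘(ℝ, Coord n)) (I' := 𝓡 (n + 1))
  have key : ∀ w : Coord n, (mfderiv (𝓡 n) (𝓡 (n + 1)) f ((extChartAt (𝓡 n) p).symm x)
          (mfderiv 𝓘(ℝ, Coord n) (𝓡 n) (extChartAt (𝓡 n) p).symm x w) : Coord (n + 1)) =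
        (mfderiv 𝓘(ℝ, Coord (n + 1)) (𝓡 (n + 1)) (extChartAt (𝓡 (n + 1)) (f p)).symm (localMap f p x)
          (fderiv ℝ (localMap f p) x w) : Coord (n + 1)) := by
    intro w
    rw [← mfderiv_eq_fderiv]
    have e1 := congrArg (fun L : Coord n →L[ℝ] Coord (n + 1) => L w) d1
    have e2 := congrArg (fun L : Coord n →L[ℝ] Coord (n + 1) => L w) d2
    have e3 := congrArg (fun L : Coord n →L[ℝ] Coord (n + 1) => L w) d3
    exact e1.symm.trans (e3.trans e2)
  have hu := key u
  have hv := key v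
  refine Eq.trans ?_ (g'.val_congr hEq.self_of_nhds _ _)
  rw [← hu, ← hv]
  rfl

end LocalMap

/-! ### Linear algebra of the normal line -/

section Normal

variable {X Y : Type*} [AddCommGroup X] [Module ℝ X] [FiniteDimensional ℝ X]
  [AddCommGroup Y] [Module ℝ Y] [FiniteDimensional ℝ Y]
  {B : Y →ₗ[ℝ] Y →ₗ[ℝ] ℝ} {D : X →ₗ[ℝ] Y}

/-- If `D` has a nondegenerate range of codimension one, the orthogonal complement of the range is a
line, and it is complementary to the range. -/
theorem exists_normal_line (hdim : Module.finrank ℝ Y = Module.finrank ℝ X + 1)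
    (hD : ∀ u, (∀ v, B (D u) (D v) = 0) → u = 0) :
    ∃ w : Y, w ≠ 0 ∧ (∀ v, B (D v) w = 0) ∧ (∀ y, (∀ v, B (D v) y = 0) → ∃ c : ℝ, y = c • w) ∧
      ∀ y, ∃ v, ∃ c : ℝ, y = D v + c • w := by
  let Φ : Y →ₗ[ℝ] Module.Dual ℝ X := (B ∘ₗ D).flip
  -- The hypothesis `hD` says that an element `u` of the bidual killed by this dual map is zero;
  -- dualising, `Φ ∘ₗ D` is onto.
  have hinj : Function.Injective (Φ ∘ₗ D).dualMap := by
    rw [injective_iff_map_eq_zero]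
    intro φ hφ
    obtain ⟨u, rfl⟩ := (Module.evalEquiv ℝ X).surjective φ
    have : u = 0 := hD u fun v => by simpa [Φ] using congrArg (fun L => L v) hφ
    simp [this]
  have hsurj : Function.Surjective (Φ ∘ₗ D) := LinearMap.dualMap_injective_iff.1 hinj
  have hΦ : Function.Surjective Φ := fun φ => (hsurj φ).elim fun v hv => ⟨D v, hv⟩
  -- The kernel of `Φ` is the orthogonal complement of the range of `D`; rank-nullity makes it a
  -- line.
  have hker : Module.finrank ℝ (LinearMap.ker Φ) = 1 := by
    have h1 := LinearMap.finrank_range_add_finrank_ker Φ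
    rw [LinearMap.range_eq_top.2 hΦ, finrank_top, Subspace.dual_finrank_eq] at h1
    omega
  obtain ⟨⟨w, hw⟩, hw0, hspan⟩ := finrank_eq_one_iff'.1 hker
  have hmem : ∀ y, (∀ v, B (D v) y = 0) → ∃ c : ℝ, y = c • w := fun y hy => by
    obtain ⟨c, hc⟩ := hspan ⟨y, LinearMap.mem_ker.2 (LinearMap.ext hy)⟩
    exact ⟨c, (congrArg Subtype.val hc).symm⟩
  refine ⟨w, fun h => hw0 (Subtype.ext h), fun v => congrArg (fun L => L v) (LinearMap.mem_ker.1 hw),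
    hmem, fun y => ?_⟩
  obtain ⟨v, hv⟩ := hsurj (Φ y)
  obtain ⟨c, hc⟩ := hmem (y - D v) fun z => by
    have := congrArg (fun L => L z) hv
    simp [Φ] at this
    simp [this]
  exact ⟨v, c, by rw [← hc]; abel⟩

/-- The normal line is not null: a null generator would be orthogonal to itself and to the range of
`D`, hence to everything. It can therefore be rescaled to length `±1`. -/
theorem exists_unit_normal (hdim : Module.finrank ℝ Y = Module.finrank ℝ X + 1)
    (hsymm : ∀ y z, B y z = B z y) (hB : ∀ y, (∀ z, B y z = 0) → y = 0)
    (hD : ∀ u, (∀ v, B (D u) (D v) = 0) → u = 0) :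
    ∃ N : Y, (B N N = 1 ∨ B N N = -1) ∧ ∀ v, B (D v) N = 0 := by
  obtain ⟨w, hw0, hw, -, hdec⟩ := exists_normal_line hdim hD
  have hww : B w w ≠ 0 := fun h => hw0 <| hB w fun y => by
    obtain ⟨v, c, rfl⟩ := hdec y
    rw [map_add, map_smul, h, hsymm, hw]
    simp
  have hs : Real.sqrt |B w w| * Real.sqrt |B w w| = |B w w| := Real.mul_self_sqrt (abs_nonneg _)
  have hs0 : Real.sqrt |B w w| ≠ 0 := by positivity
  refine ⟨(Real.sqrt |B w w|)⁻¹ • w, ?_, fun v => by simp [hw]⟩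
  have : B ((Real.sqrt |B w w|)⁻¹ • w) ((Real.sqrt |B w w|)⁻¹ • w) = B w w / |B w w| := by
    simp only [map_smul, LinearMap.smul_apply, smul_eq_mul]
    rw [← mul_assoc, ← mul_inv, hs, div_eq_inv_mul]
  rw [this]
  rcases lt_or_gt_of_ne hww with h | h
  · right; rw [abs_of_neg h, div_neg, div_self hww]
  · left; rw [abs_of_pos h, div_self hww]

/-- All three vectors are multiples of one generator of the normal line, and `B N N` has square `1`.
-/
theorem form_eq_of_normal (hdim : Module.finrank ℝ Y = Module.finrank ℝ X + 1)
    (hD : ∀ u, (∀ v, B (D u) (D v) = 0) → u = 0)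
    {N : Y} (hN : B N N = 1 ∨ B N N = -1) (hDN : ∀ v, B (D v) N = 0) {y z : Y}
    (hy : ∀ v, B (D v) y = 0) (hz : ∀ v, B (D v) z = 0) :
    B y z = B N N * (B y N * B z N) := by
  obtain ⟨w, -, -, hline, -⟩ := exists_normal_line hdim hD
  obtain ⟨a, rfl⟩ := hline N hDN
  obtain ⟨b, rfl⟩ := hline y hy
  obtain ⟨c, rfl⟩ := hline z hz
  simp only [map_smul, LinearMap.smul_apply, smul_eq_mul] at hN ⊢
  have h1 : (a * (a * B w w)) * (a * (a * B w w)) = 1 := by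
    rcases hN with h | h <;> rw [h] <;> norm_num
  linear_combination (- (b * c * B w w)) * h1

end Normal

/-! ### Compatibility with wedge-type tensors -/

section Algebra

variable {n : ℕ}

/-- The tensor `P_{jl} Q_k{}^m - Q_j{}^m P_{kl}`. -/
def wedge (P Q : Matrix (Fin n) (Fin n) ℝ) (j k l m : Fin n) : ℝ :=
  P j l * Q k m - Q j m * P k l

theorem TensorCompatible.add {K L : Fin n → Fin n → Fin n → Fin n → ℝ} {b : Fin n → Fin n → ℝ}
    (hK : TensorCompatible K b) (hL : TensorCompatible L b) : TensorCompatible (K + L) b := by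
  refine ⟨hK.1, fun i j k l => ?_⟩
  have := congrArg₂ (· + ·) (hK.2 i j k l) (hL.2 i j k l)
  simp only [← Finset.sum_add_distrib, add_zero] at this
  rw [← this]
  exact Finset.sum_congr rfl fun m _ => by simp only [Pi.add_apply]; ring

theorem TensorCompatible.smul {K : Fin n → Fin n → Fin n → Fin n → ℝ} {b : Fin n → Fin n → ℝ}
    (hK : TensorCompatible K b) (c : ℝ) : TensorCompatible (c • K) b := by
  refine ⟨hK.1, fun i j k l => ?_⟩
  have := congrArg (c * ·) (hK.2 i j k l)
  simp only [Finset.mul_sum, mul_zero] at this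
  rw [← this]
  exact Finset.sum_congr rfl fun m _ => by simp only [Pi.smul_apply, smul_eq_mul]; ring

/-- After contraction each `P` multiplies a difference `S_{ik} - S_{ki}` with `S = b Qᵀ`, which is
zero by symmetry. -/
theorem tensorCompatible_wedge {P Q b : Matrix (Fin n) (Fin n) ℝ} (hb : b.IsSymm)
    (hbQ : (b * Q.transpose).IsSymm) : TensorCompatible (wedge P Q) b := by
  refine ⟨fun i j => hb.apply j i, fun i j k l => ?_⟩
  have hS : ∀ a c, ∑ m, b a m * Q c m = (b * Q.transpose) a c := fun a c => by
    simp [Matrix.mul_apply]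
  have ht : ∀ m, b i m * wedge P Q j k l m + b j m * wedge P Q k i l m + b k m * wedge P Q i j l m
      = P j l * (b i m * Q k m) - P k l * (b i m * Q j m) + (P k l * (b j m * Q i m)
        - P i l * (b j m * Q k m)) + (P i l * (b k m * Q j m) - P j l * (b k m * Q i m)) :=
    fun m => by simp only [wedge]; ring
  simp only [ht, Finset.sum_add_distrib, Finset.sum_sub_distrib, ← Finset.mul_sum, hS]
  rw [hbQ.apply i j, hbQ.apply i k, hbQ.apply j k]
  ring

/-- The covector form of compatibility: `(w_i K_{jkl}{}^m + w_j K_{kil}{}^m + w_k K_{ijl}{}^m) w_m = 0`. -/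
def CovectorCompatible (K : Fin n → Fin n → Fin n → Fin n → ℝ) (w : Fin n → ℝ) : Prop :=
  ∀ i j k l, ∑ m, (w i * K j k l m + w j * K k i l m + w k * K i j l m) * w m = 0

theorem CovectorCompatible.add {K L : Fin n → Fin n → Fin n → Fin n → ℝ} {w : Fin n → ℝ}
    (hK : CovectorCompatible K w) (hL : CovectorCompatible L w) : CovectorCompatible (K + L) w := by
  intro i j k l
  have := congrArg₂ (· + ·) (hK i j k l) (hL i j k l)
  simp only [← Finset.sum_add_distrib, add_zero] at this
  rw [← this]
  exact Finset.sum_congr rfl fun m _ => by simp only [Pi.add_apply]; ring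

theorem CovectorCompatible.smul {K : Fin n → Fin n → Fin n → Fin n → ℝ} {w : Fin n → ℝ}
    (hK : CovectorCompatible K w) (c : ℝ) : CovectorCompatible (c • K) w := by
  intro i j k l
  have := congrArg (c * ·) (hK i j k l)
  simp only [Finset.mul_sum, mul_zero] at this
  rw [← this]
  exact Finset.sum_congr rfl fun m _ => by simp only [Pi.smul_apply, smul_eq_mul]; ring

/-- Contracting `Q` with `w` produces `c w`, and the six resulting terms cancel in pairs. -/
theorem covectorCompatible_wedge {P Q : Matrix (Fin n) (Fin n) ℝ} {w : Fin n → ℝ} {c : ℝ}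
    (hw : Q.mulVec w = c • w) : CovectorCompatible (wedge P Q) w := by
  intro i j k l
  have hS : ∀ a, ∑ m, Q a m * w m = c * w a := fun a => congrFun hw a
  have ht : ∀ m, (w i * wedge P Q j k l m + w j * wedge P Q k i l m + w k * wedge P Q i j l m) * w m
      = w i * P j l * (Q k m * w m) - w i * P k l * (Q j m * w m) + (w j * P k l * (Q i m * w m)
        - w j * P i l * (Q k m * w m)) + (w k * P i l * (Q j m * w m)
        - w k * P j l * (Q i m * w m)) :=
    fun m => by simp only [wedge]; ring
  simp only [ht, Finset.sum_add_distrib, Finset.sum_sub_distrib, ← Finset.mul_sum, hS]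
  ring

/-- If `a w_k w_l + b g_{kl}`, with `a ≠ 0`, and `g_{kl}` are `K`-compatible, then so is `w`. -/
theorem CovectorCompatible.of_tensorCompatible {K : Fin n → Fin n → Fin n → Fin n → ℝ}
    {T g : Fin n → Fin n → ℝ} {w : Fin n → ℝ} {a b : ℝ} (ha : a ≠ 0)
    (hT : TensorCompatible K T) (hg : TensorCompatible K g)
    (h : ∀ k l, T k l = a * w k * w l + b * g k l) : CovectorCompatible K w := by
  intro i j k l
  have h1 := hT.2 i j k l
  have h2 := hg.2 i j k l
  have h3 : ∑ m, (T i m * K j k l m + T j m * K k i l m + T k m * K i j l m)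
      = a * ∑ m, (w i * K j k l m + w j * K k i l m + w k * K i j l m) * w m
        + b * ∑ m, (g i m * K j k l m + g j m * K k i l m + g k m * K i j l m) := by
    rw [Finset.mul_sum, Finset.mul_sum, ← Finset.sum_add_distrib]
    exact Finset.sum_congr rfl fun m _ => by rw [h, h, h]; ring
  rw [h1, h2, mul_zero, add_zero] at h3
  exact (mul_eq_zero.1 h3.symm).resolve_left ha

/-- If `w` is `K`-compatible and `u^i w_i = -1`, then `K_{jkl}{}^m w_m` vanishes on pairs `j, k` of
vectors annihilated by `w`. -/
theorem CovectorCompatible.exists_decomposition {K : Fin n → Fin n → Fin n → Fin n → ℝ}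
    {w u : Fin n → ℝ} (hK : CovectorCompatible K w) (hu : ∑ i, u i * w i = -1) :
    ∃ X Y : Fin n → Fin n → ℝ, ∀ j k l, ∑ m, K j k l m * w m = w j * X k l + w k * Y j l := by
  refine ⟨fun k l => ∑ i, u i * ∑ m, K k i l m * w m, fun j l => ∑ i, u i * ∑ m, K i j l m * w m,
    fun j k l => ?_⟩
  -- Contract the cyclic identity with `u^i`; the normalisation `-1` isolates the first term.
  have h : ∀ i, u i * w i * ∑ m, K j k l m * w m + w j * (u i * ∑ m, K k i l m * w m)
      + w k * (u i * ∑ m, K i j l m * w m) = 0 := by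
    intro i
    have h1 : w i * ∑ m, K j k l m * w m + w j * ∑ m, K k i l m * w m
        + w k * ∑ m, K i j l m * w m = 0 := by
      rw [← hK i j k l, Finset.mul_sum, Finset.mul_sum, Finset.mul_sum, ← Finset.sum_add_distrib,
        ← Finset.sum_add_distrib]
      exact Finset.sum_congr rfl fun m _ => by ring
    linear_combination u i * h1
  have h2 := Finset.sum_congr rfl fun i (_ : i ∈ Finset.univ) => h i
  simp only [Finset.sum_add_distrib, ← Finset.mul_sum, ← Finset.sum_mul, hu,
    Finset.sum_const_zero] at h2
  linarith

/-- The contraction of an antisymmetric array with a symmetric product vanishes. -/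
theorem sum_mul_mul_eq_zero_of_antisymm {A : Fin n → Fin n → ℝ} (hA : ∀ i j, A i j = - A j i)
    (u : Fin n → ℝ) : ∑ i, ∑ j, u i * u j * A i j = 0 := by
  have h : ∑ i, ∑ j, u i * u j * A i j = - ∑ i, ∑ j, u i * u j * A i j := by
    conv_lhs => rw [Finset.sum_comm]
    simp only [← Finset.sum_neg_distrib]
    exact Finset.sum_congr rfl fun i _ => Finset.sum_congr rfl fun j _ => by rw [hA]; ring
  linarith

end Algebra

/-! ### Consequences of the algebraic Gauss equation at a point -/

section HypersurfaceAlgebra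

variable {n : ℕ} {M : Type*} [TopologicalSpace M] [ChartedSpace (Coord n) M]
  [IsManifold (𝓡 n) ∞ M] {g : PseudoRiemannianMetric n M} {p : M}

theorem metric_isSymm (g : PseudoRiemannianMetric n M) (p : M) : (metric g p).IsSymm := by
  ext i j
  exact g.symm p _ _

/-- `g_p` as a bilinear form on `ℝⁿ`. -/
def valForm (g : PseudoRiemannianMetric n M) (p : M) : Coord n →L[ℝ] Coord n →L[ℝ] ℝ := g.val p

theorem val_eq_sum_lower (u v : TangentSpace (𝓡 n) p) :
    g.val p u v = ∑ i, coords u i * lower g p v i := by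
  change valForm g p (coords u) (coords v) = ∑ i, coords u i * valForm g p (e i) (coords v)
  conv_lhs => rw [← sum_smul_e (coords u)]
  simp only [map_sum, map_smul, sum_apply, smul_apply, smul_eq_mul]

theorem lower_eq_mulVec (u : TangentSpace (𝓡 n) p) :
    lower g p u = (metric g p).mulVec (coords u) := by
  ext i
  refine (g.symm p _ _).trans ((val_eq_sum_lower _ _).trans (Finset.sum_congr rfl fun j _ => ?_))
  rw [mul_comm]
  exact congrArg (· * _) (g.symm p _ _)

theorem metric_det_ne_zero (g : PseudoRiemannianMetric n M) (p : M) : (metric g p).det ≠ 0 := by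
  intro h
  obtain ⟨v, hv, hv0⟩ := Matrix.exists_mulVec_eq_zero_iff.2 h
  refine hv (congrArg WithLp.ofLp (?_ : WithLp.toLp 2 v = (0 : Coord n)))
  refine g.nondegenerate p (WithLp.toLp 2 v : Coord n) fun u => ?_
  refine (g.symm p _ _).trans ((val_eq_sum_lower _ _).trans ?_)
  refine Finset.sum_eq_zero fun i _ => mul_eq_zero_of_right _ ?_
  exact (congrFun (lower_eq_mulVec (g := g) (p := p) (WithLp.toLp 2 v : Coord n)) i).trans
    (congrFun hv0 i)

theorem inv_metric_mulVec_lower (u : TangentSpace (𝓡 n) p) :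
    (metric g p)⁻¹.mulVec (lower g p u) = coords u := by
  rw [lower_eq_mulVec, Matrix.mulVec_mulVec,
    Matrix.nonsing_inv_mul _ (isUnit_iff_ne_zero.2 (metric_det_ne_zero g p)), Matrix.one_mulVec]

/-- The algebraic form of the Gauss equation of a hypersurface in a space of constant curvature. -/
def IsGaussCurvature (g : PseudoRiemannianMetric n M) (p : M) (κ ε : ℝ)
    (Ω : Matrix (Fin n) (Fin n) ℝ) : Prop :=
  ∀ j k l m, lowerLast g p (riemann g p) j k l m =
    κ * (metric g p j l * metric g p k m - metric g p j m * metric g p k l)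
      + ε * (Ω j l * Ω k m - Ω j m * Ω k l)

variable {κ ε : ℝ} {Ω : Matrix (Fin n) (Fin n) ℝ}

theorem IsGaussCurvature.riemann_eq (h : IsGaussCurvature g p κ ε Ω) :
    riemann g p = κ • wedge (metric g p) 1 + ε • wedge Ω (Ω * (metric g p)⁻¹) := by
  have hu := isUnit_iff_ne_zero.2 (metric_det_ne_zero g p)
  ext j k l m
  have h1 : riemann g p j k l m = ∑ s, lowerLast g p (riemann g p) j k l s * (metric g p)⁻¹ s m := by
    have : ∀ s, lowerLast g p (riemann g p) j k l s
        = (Matrix.vecMul (riemann g p j k l) (metric g p)) s := fun s => rfl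
    simp only [this]
    change _ = (Matrix.vecMul (Matrix.vecMul (riemann g p j k l) (metric g p)) (metric g p)⁻¹) m
    rw [Matrix.vecMul_vecMul, Matrix.mul_nonsing_inv _ hu, Matrix.vecMul_one]
  have hG : ∀ a, ∑ s, metric g p a s * (metric g p)⁻¹ s m = (1 : Matrix (Fin n) (Fin n) ℝ) a m := by
    intro a
    rw [← Matrix.mul_nonsing_inv _ hu, Matrix.mul_apply]
  have hΩ : ∀ a, ∑ s, Ω a s * (metric g p)⁻¹ s m = (Ω * (metric g p)⁻¹) a m := fun a => rfl
  have ht : ∀ s, lowerLast g p (riemann g p) j k l s * (metric g p)⁻¹ s m =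
      κ * (metric g p j l * (metric g p k s * (metric g p)⁻¹ s m)
        - metric g p k l * (metric g p j s * (metric g p)⁻¹ s m))
      + ε * (Ω j l * (Ω k s * (metric g p)⁻¹ s m) - Ω k l * (Ω j s * (metric g p)⁻¹ s m)) := by
    intro s; rw [h j k l s]; ring
  rw [h1]
  simp only [ht, Finset.sum_add_distrib, Finset.sum_sub_distrib, ← Finset.mul_sum, hG, hΩ,
    Pi.add_apply, Pi.smul_apply, smul_eq_mul, wedge]
  ring

/-- The trace over the second and fourth indices of `wedge P Q` is `(tr Q) P - Q P`, which gives `(n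
- 1) g` for the constant curvature part. -/
theorem IsGaussCurvature.ricci_eq (h : IsGaussCurvature g p κ ε Ω) :
    Matrix.of (ricci g p) = (κ * ((n : ℝ) - 1)) • metric g p
      + ε • ((Ω * (metric g p)⁻¹).trace • Ω - Ω * (metric g p)⁻¹ * Ω) := by
  ext a b
  simp only [Matrix.of_apply, ricci, h.riemann_eq, Pi.add_apply, Pi.smul_apply, smul_eq_mul, wedge,
    Finset.sum_add_distrib, ← Finset.mul_sum, Finset.sum_sub_distrib, Matrix.add_apply,
    Matrix.smul_apply, Matrix.sub_apply, Matrix.trace, Matrix.diag, Matrix.mul_apply (M := _ * _)]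
  simp [Matrix.one_apply]
  ring

/-- Besides Riemann only wedges with second factor the identity or the Ricci endomorphism occur, so
the wedge criteria apply to Weyl as well. -/
theorem weyl_eq (g : PseudoRiemannianMetric n M) (p : M) :
    weyl g p = riemann g p + (-(1 / ((n : ℝ) - 2))) • (wedge (Matrix.of (ricci g p)) 1
      + wedge (metric g p) (Matrix.of (ricci g p) * (metric g p)⁻¹))
      + (scalar g p / (((n : ℝ) - 1) * ((n : ℝ) - 2))) • wedge (metric g p) 1 := by
  ext j k l m
  have hR : ∀ a, (Matrix.of (ricci g p) * (metric g p)⁻¹) a m = ricciUp g p a m := fun a => rfl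
  have hδ : ∀ a, (1 : Matrix (Fin n) (Fin n) ℝ) a m = δ a m := fun a => by
    simp [Matrix.one_apply, δ]
  simp only [weyl, Pi.add_apply, Pi.smul_apply, smul_eq_mul, wedge, hR, hδ, Matrix.of_apply]
  ring

theorem inv_metric_isSymm (g : PseudoRiemannianMetric n M) (p : M) : ((metric g p)⁻¹).IsSymm := by
  rw [Matrix.IsSymm, Matrix.transpose_nonsing_inv, metric_isSymm]

/-- `b` and `P` commute as endomorphisms. -/
def MetricCommute (g : PseudoRiemannianMetric n M) (p : M) (b P : Matrix (Fin n) (Fin n) ℝ) : Prop :=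
  b * (metric g p)⁻¹ * P = P * (metric g p)⁻¹ * b

theorem metricCommute_metric (b : Matrix (Fin n) (Fin n) ℝ) : MetricCommute g p b (metric g p) := by
  have hu := isUnit_iff_ne_zero.2 (metric_det_ne_zero g p)
  rw [MetricCommute, Matrix.mul_assoc, Matrix.nonsing_inv_mul _ hu, Matrix.mul_nonsing_inv _ hu,
    mul_one, one_mul]

/-- Ricci is a polynomial in `Ω`, so whatever commutes with `Ω` commutes with it. -/
theorem MetricCommute.ricci {b : Matrix (Fin n) (Fin n) ℝ} (h : IsGaussCurvature g p κ ε Ω)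
    (hb : MetricCommute g p b Ω) : MetricCommute g p b (Matrix.of (ricci g p)) := by
  have h1 : MetricCommute g p b (Ω * (metric g p)⁻¹ * Ω) := by
    have hb' : b * (metric g p)⁻¹ * Ω = Ω * (metric g p)⁻¹ * b := hb
    calc b * (metric g p)⁻¹ * (Ω * (metric g p)⁻¹ * Ω)
        = (b * (metric g p)⁻¹ * Ω) * (metric g p)⁻¹ * Ω := by simp only [Matrix.mul_assoc]
      _ = Ω * (metric g p)⁻¹ * (b * (metric g p)⁻¹ * Ω) := by
        rw [hb']; simp only [Matrix.mul_assoc]; simp only [← Matrix.mul_assoc, hb']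
      _ = Ω * (metric g p)⁻¹ * Ω * (metric g p)⁻¹ * b := by
        rw [hb']; simp only [Matrix.mul_assoc]
  have h2 : MetricCommute g p b (metric g p) := metricCommute_metric b
  unfold MetricCommute at *
  rw [h.ricci_eq]
  simp only [mul_add, mul_sub, add_mul, sub_mul, Matrix.mul_smul, Matrix.smul_mul, h1, h2, hb]

/-- For symmetric `b` and `P`, the product `b g⁻¹ P` is symmetric exactly when `b` and `P` commute
as endomorphisms. -/
theorem tensorCompatible_wedge_inv {b P : Matrix (Fin n) (Fin n) ℝ} (hb : b.IsSymm) (hP : P.IsSymm)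
    (hbP : MetricCommute g p b P) (Q : Matrix (Fin n) (Fin n) ℝ) :
    TensorCompatible (wedge Q (P * (metric g p)⁻¹)) b := by
  refine tensorCompatible_wedge hb ?_
  rw [Matrix.transpose_mul, inv_metric_isSymm, hP, ← Matrix.mul_assoc, Matrix.IsSymm,
    Matrix.transpose_mul, Matrix.transpose_mul, inv_metric_isSymm, hP, hb, ← Matrix.mul_assoc]
  exact hbP.symm

theorem tensorCompatible_wedge_one {b : Matrix (Fin n) (Fin n) ℝ} (hb : b.IsSymm)
    (Q : Matrix (Fin n) (Fin n) ℝ) : TensorCompatible (wedge Q 1) b :=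
  tensorCompatible_wedge hb (by simpa using hb)

theorem IsGaussCurvature.ricci_isSymm (h : IsGaussCurvature g p κ ε Ω) (hΩ : Ω.IsSymm) :
    (Matrix.of (ricci g p)).IsSymm := by
  rw [h.ricci_eq, Matrix.IsSymm]
  simp only [Matrix.transpose_add, Matrix.transpose_sub, Matrix.transpose_smul,
    Matrix.transpose_mul]
  rw [metric_isSymm, inv_metric_isSymm, hΩ, Matrix.mul_assoc]

theorem IsGaussCurvature.riemannCompatible (h : IsGaussCurvature g p κ ε Ω) (hΩ : Ω.IsSymm)
    {b : Matrix (Fin n) (Fin n) ℝ} (hb : b.IsSymm) (hbΩ : MetricCommute g p b Ω) :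
    RiemannCompatible g p b := by
  change TensorCompatible (riemann g p) b
  rw [h.riemann_eq]
  exact ((tensorCompatible_wedge_one hb _).smul κ).add
    ((tensorCompatible_wedge_inv hb hΩ hbΩ _).smul ε)

theorem IsGaussCurvature.weylCompatible (h : IsGaussCurvature g p κ ε Ω) (hΩ : Ω.IsSymm)
    {b : Matrix (Fin n) (Fin n) ℝ} (hb : b.IsSymm) (hbΩ : MetricCommute g p b Ω) :
    WeylCompatible g p b := by
  change TensorCompatible (weyl g p) b
  rw [weyl_eq]
  exact ((h.riemannCompatible hΩ hb hbΩ).add (((tensorCompatible_wedge_one hb _).add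
    (tensorCompatible_wedge_inv hb (h.ricci_isSymm hΩ) (hbΩ.ricci h) _)).smul _)).add
    ((tensorCompatible_wedge_one hb _).smul _)

/-- An eigenvector of `Ω` is an eigenvector of every second factor in the wedge expansions of
Riemann and Weyl. -/
theorem IsGaussCurvature.vectorCompatible (h : IsGaussCurvature g p κ ε Ω)
    {c : ℝ} {u : TangentSpace (𝓡 n) p} (hu : IsEigenvector g p Ω c u) :
    VectorCompatible g p (riemann g p) u ∧ VectorCompatible g p (weyl g p) u := by
  have hΩ : Ω.mulVec (coords u) = c • lower g p u := funext hu.2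
  have hΩ' : (Ω * (metric g p)⁻¹).mulVec (lower g p u) = c • lower g p u := by
    rw [← Matrix.mulVec_mulVec, inv_metric_mulVec_lower, hΩ]
  have h1 : ∀ Q, CovectorCompatible (wedge Q 1) (lower g p u) := fun Q =>
    covectorCompatible_wedge (c := 1) (by simp)
  have hR : CovectorCompatible (riemann g p) (lower g p u) := by
    rw [h.riemann_eq]
    exact ((h1 _).smul κ).add ((covectorCompatible_wedge hΩ').smul ε)
  refine ⟨hR, ?_⟩
  change CovectorCompatible (weyl g p) (lower g p u)
  rw [weyl_eq]
  -- The eigenvalue of Ricci on `u`, read off from `IsGaussCurvature.ricci_eq` with `Ω` replaced by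
  -- `c`.
  refine (hR.add (((h1 _).add (covectorCompatible_wedge (c := κ * ((n : ℝ) - 1)
    + ε * ((Ω * (metric g p)⁻¹).trace * c - c * c)) ?_)).smul _)).add ((h1 _).smul _)
  rw [← Matrix.mulVec_mulVec, inv_metric_mulVec_lower, h.ricci_eq, Matrix.add_mulVec,
    Matrix.smul_mulVec, Matrix.smul_mulVec, Matrix.sub_mulVec, Matrix.smul_mulVec,
    ← Matrix.mulVec_mulVec, hΩ, Matrix.mulVec_smul, hΩ', ← lower_eq_mulVec]
  simp only [smul_smul, add_smul, mul_sub, sub_smul, smul_sub]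

theorem sum_lowerLast_mul (K : Fin n → Fin n → Fin n → Fin n → ℝ) (u : TangentSpace (𝓡 n) p)
    (j k l : Fin n) :
    ∑ m, lowerLast g p K j k l m * coords u m = ∑ m, K j k l m * lower g p u m := by
  rw [lower_eq_mulVec]
  exact (Matrix.dotProduct_mulVec (K j k l) (metric g p) (coords u)).symm

/-- In `u_j X_{kl} + u_k Y_{jl}` each term contains a factor `u_j x^j` or `u_k y^k`. -/
theorem weylPurelyElectric_of_vectorCompatible {u : TangentSpace (𝓡 n) p}
    (hu : VectorCompatible g p (weyl g p) u) (hunit : g.val p u u = -1) :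
    WeylPurelyElectric g p u := by
  obtain ⟨X, Y, hXY⟩ := CovectorCompatible.exists_decomposition (u := coords u) hu
    (by rw [← val_eq_sum_lower, hunit])
  intro x y z hx hy _
  rw [val_eq_sum_lower] at hx hy
  have h1 : ∀ j k l, ∑ m, lowerLast g p (weyl g p) j k l m * coords x j * coords y k * coords z l
      * coords u m = (coords x j * lower g p u j) * (coords y k * coords z l * X k l)
        + (coords y k * lower g p u k) * (coords x j * coords z l * Y j l) := by
    intro j k l
    have h2 := hXY j k l
    rw [← sum_lowerLast_mul] at h2
    calc _ = coords x j * coords y k * coords z l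
          * ∑ m, lowerLast g p (weyl g p) j k l m * coords u m := by
          rw [Finset.mul_sum]
          exact Finset.sum_congr rfl fun m _ => by ring
      _ = _ := by rw [h2]; ring
  simp only [weylForm, h1, Finset.sum_add_distrib, ← Finset.mul_sum, ← Finset.sum_mul, hx, hy,
    zero_mul, add_zero]

theorem volumeFour_swap_first_third (h : n = 4) (a b r s : Fin n) :
    volumeFour h g p a b r s = - volumeFour h g p r b a s := by
  have := Matrix.det_permute (Equiv.swap (0 : Fin 4) 2)
    (Matrix.of fun i k : Fin 4 => δ (![a, b, r, s] i) (Fin.cast h.symm k))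
  have h2 : (Matrix.of fun i k : Fin 4 => δ (![a, b, r, s] i) (Fin.cast h.symm k)).submatrix
      (Equiv.swap (0 : Fin 4) 2) id
      = Matrix.of fun i k : Fin 4 => δ (![r, b, a, s] i) (Fin.cast h.symm k) := by
    ext i k
    fin_cases i <;> rfl
  rw [h2, Equiv.Perm.sign_swap (by decide)] at this
  rw [volumeFour, volumeFour, this]
  simp

theorem volumeFour_swap_first_fourth (h : n = 4) (a b r s : Fin n) :
    volumeFour h g p a b r s = - volumeFour h g p s b r a := by
  have := Matrix.det_permute (Equiv.swap (0 : Fin 4) 3)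
    (Matrix.of fun i k : Fin 4 => δ (![a, b, r, s] i) (Fin.cast h.symm k))
  have h2 : (Matrix.of fun i k : Fin 4 => δ (![a, b, r, s] i) (Fin.cast h.symm k)).submatrix
      (Equiv.swap (0 : Fin 4) 3) id
      = Matrix.of fun i k : Fin 4 => δ (![s, b, r, a] i) (Fin.cast h.symm k) := by
    ext i k
    fin_cases i <;> rfl
  rw [h2, Equiv.Perm.sign_swap (by decide)] at this
  rw [volumeFour, volumeFour, this]
  simp

/-- After raising indices, each term of the decomposition contains `u^r` or `u^s`, which together
with `u^j` meets two antisymmetric slots of `ε_{jars}`. -/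
theorem magneticWeyl_eq_zero_of_vectorCompatible {u : TangentSpace (𝓡 n) p}
    (hu : VectorCompatible g p (weyl g p) u) (hunit : g.val p u u = -1) (h : n = 4)
    (a b : Fin n) : magneticWeyl h g p u a b = 0 := by
  obtain ⟨X, Y, hXY⟩ := CovectorCompatible.exists_decomposition (u := coords u) hu
    (by rw [← val_eq_sum_lower, hunit])
  have hup : ∀ r, ∑ r', (metric g p)⁻¹ r r' * lower g p u r' = coords u r :=
    fun r => congrFun (inv_metric_mulVec_lower u) r
  have hraise : ∀ r s, ∑ r', ∑ s', (metric g p)⁻¹ r r' * (metric g p)⁻¹ s s' *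
      ∑ m, lowerLast g p (weyl g p) r' s' b m * coords u m
      = coords u r * ∑ s', (metric g p)⁻¹ s s' * X s' b
        + coords u s * ∑ r', (metric g p)⁻¹ r r' * Y r' b := by
    intro r s
    rw [← hup r, ← hup s, Finset.sum_mul_sum, Finset.sum_mul_sum, Finset.sum_comm (s := Finset.univ)
      (t := Finset.univ) (f := fun i j => (metric g p)⁻¹ s i * lower g p u i
        * ((metric g p)⁻¹ r j * Y j b)), ← Finset.sum_add_distrib]
    refine Finset.sum_congr rfl fun r' _ => ?_
    rw [← Finset.sum_add_distrib]
    refine Finset.sum_congr rfl fun s' _ => ?_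
    rw [sum_lowerLast_mul, hXY]
    ring
  -- The sum over `m` is moved inside, so that the Weyl tensor appears contracted with `u` and
  -- `hraise` applies.
  have hdual : ∀ j, ∑ m, coords u j * coords u m * dualWeyl h g p j a b m
      = 1 / 2 * ∑ r, ∑ s, coords u j * volumeFour h g p j a r s * ∑ r', ∑ s',
        (metric g p)⁻¹ r r' * (metric g p)⁻¹ s s' *
          ∑ m, lowerLast g p (weyl g p) r' s' b m * coords u m := by
    intro j
    simp only [dualWeyl, Finset.mul_sum]
    rw [Finset.sum_comm]
    refine Finset.sum_congr rfl fun r _ => ?_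
    rw [Finset.sum_comm]
    refine Finset.sum_congr rfl fun s _ => ?_
    rw [Finset.sum_comm]
    refine Finset.sum_congr rfl fun r' _ => ?_
    rw [Finset.sum_comm]
    exact Finset.sum_congr rfl fun s' _ => Finset.sum_congr rfl fun m _ => by ring
  have h1 : ∀ s, ∑ j, ∑ r, coords u j * coords u r * volumeFour h g p j a r s = 0 := fun s =>
    sum_mul_mul_eq_zero_of_antisymm (A := fun j r => volumeFour h g p j a r s)
      (fun _ _ => volumeFour_swap_first_third h _ _ _ _) _
  have h2 : ∀ r, ∑ j, ∑ s, coords u j * coords u s * volumeFour h g p j a r s = 0 := fun r =>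
    sum_mul_mul_eq_zero_of_antisymm (A := fun j s => volumeFour h g p j a r s)
      (fun _ _ => volumeFour_swap_first_fourth h _ _ _ _) _
  simp only [magneticWeyl, hdual, hraise, ← Finset.mul_sum]
  have hX : ∑ j, ∑ r, ∑ s, (coords u j * coords u r * volumeFour h g p j a r s)
      * ∑ s', (metric g p)⁻¹ s s' * X s' b = 0 := by
    have : ∀ j, ∑ r, ∑ s, (coords u j * coords u r * volumeFour h g p j a r s)
      * ∑ s', (metric g p)⁻¹ s s' * X s' b = ∑ s, ∑ r, (coords u j * coords u r
        * volumeFour h g p j a r s) * ∑ s', (metric g p)⁻¹ s s' * X s' b :=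
      fun j => Finset.sum_comm
    simp only [this]
    rw [Finset.sum_comm]
    simp only [← Finset.sum_mul, h1, zero_mul, Finset.sum_const_zero]
  have hY : ∑ j, ∑ r, ∑ s, (coords u j * coords u s * volumeFour h g p j a r s)
      * ∑ r', (metric g p)⁻¹ r r' * Y r' b = 0 := by
    rw [Finset.sum_comm]
    simp only [← Finset.sum_mul, h2, zero_mul, Finset.sum_const_zero]
  have hXY' := congrArg₂ (· + ·) hX hY
  simp only [← Finset.sum_add_distrib, add_zero] at hXY'
  rw [mul_eq_zero]
  right
  rw [← hXY']
  exact Finset.sum_congr rfl fun j _ => Finset.sum_congr rfl fun r _ =>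
    Finset.sum_congr rfl fun s _ => by ring

end HypersurfaceAlgebra

/-! ### The Gauss equation for a hypersurface of a manifold -/

section GaussOnManifolds

variable {n : ℕ} {M : Type*} [TopologicalSpace M] [ChartedSpace (Coord n) M]
  [IsManifold (𝓡 n) ∞ M]

theorem bilin_inChart (g : PseudoRiemannianMetric n M) (p : M) (x u v : Coord n) :
    bilin (fun i j => g.inChart p x i j) u v = g.val ((extChartAt (𝓡 n) p).symm x)
      (mfderiv 𝓘(ℝ, Coord n) (𝓡 n) (extChartAt (𝓡 n) p).symm x u)
      (mfderiv 𝓘(ℝ, Coord n) (𝓡 n) (extChartAt (𝓡 n) p).symm x v) := by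
  let L : Coord n →L[ℝ] Coord n := mfderiv 𝓘(ℝ, Coord n) (𝓡 n) (extChartAt (𝓡 n) p).symm x
  have h := bilin_of_apply_e ((valForm g ((extChartAt (𝓡 n) p).symm x)).bilinearComp L L)
  exact congrArg (fun B : Coord n →L[ℝ] Coord n →L[ℝ] ℝ => B u v) h

theorem bilin_metric (g : PseudoRiemannianMetric n M) (p : M) :
    bilin (fun i j => metric g p i j) = valForm g p :=
  bilin_of_apply_e (valForm g p)

theorem contDiffAt_inChart (g : PseudoRiemannianMetric n M) {p : M} {x : Coord n}
    (hx : x ∈ (extChartAt (𝓡 n) p).target) (i j : Fin n) :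
    ContDiffAt ℝ ∞ (fun y => g.inChart p y i j) x :=
  contDiffAt_val_mfderiv g hx (e i) (e j)

/-- The determinant of the coefficients is continuous and nonzero at `p`, hence nonzero nearby. -/
theorem eventually_isLeviCivitaAt (g : PseudoRiemannianMetric n M) (p : M) :
    ∀ᶠ x in 𝓝 (extChartAt (𝓡 n) p p),
      IsLeviCivitaAt (fun y => bilin fun i j => g.inChart p y i j)
        (connectionForm (g.inChart p)) x := by
  have hdet : ContinuousAt (fun x => (g.inChart p x).det) (extChartAt (𝓡 n) p p) :=
    (ContDiffAt.matrix_det (k := ∞)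
      fun i j => contDiffAt_inChart g (mem_extChartAt_target p) i j).continuousAt
  filter_upwards [extChartAt_target_mem_nhds (I := 𝓡 n) p,
    hdet.eventually_ne (by rw [g.inChart_self]; exact metric_det_ne_zero g p)] with x hx hx'
  refine isLeviCivitaAt_connectionForm (fun i j => ?_) hx' ?_
  · ext y
    exact g.symm _ _ _
  · exact (ContDiffAt.bilin fun i j => contDiffAt_inChart g hx i j).differentiableAt (by simp)

theorem differentiableAt_connectionForm_inChart (g : PseudoRiemannianMetric n M) (p : M) :
    DifferentiableAt ℝ (connectionForm (g.inChart p)) (extChartAt (𝓡 n) p p) :=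
  differentiableAt_connectionForm
    (fun i j => contDiffAt_infty.1 (contDiffAt_inChart g (mem_extChartAt_target p) i j) 2)
    (by rw [g.inChart_self]; exact metric_det_ne_zero g p)

/-- The curvature operator at `p`, in the preferred chart. -/
def curvatureAt (g : PseudoRiemannianMetric n M) (p : M) (u v w : Coord n) : Coord n :=
  curvature (connectionForm (g.inChart p)) (extChartAt (𝓡 n) p p) u v w

theorem valForm_curvatureAt_e (g : PseudoRiemannianMetric n M) (p : M) (j k l m : Fin n) :
    valForm g p (curvatureAt g p (e j) (e k) (e l)) (e m) = lowerLast g p (riemann g p) j k l m := by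
  refine (val_eq_sum_lower _ _).trans (Finset.sum_congr rfl fun s _ => ?_)
  exact congrArg (· * _)
    (curvature_connectionForm_e (differentiableAt_connectionForm_inChart g p) j k l s)

/-- Extension from the coordinate frame to all vectors is needed because the Gauss equation
evaluates the ambient curvature on images of tangent vectors of `M`. -/
theorem valForm_curvatureAt_of_constant {g : PseudoRiemannianMetric n M} {p : M} {κ : ℝ}
    (h : ∀ j k l m : Fin n, lowerLast g p (riemann g p) j k l m =
      κ * (metric g p j l * metric g p k m - metric g p j m * metric g p k l))
    (u v w z : Coord n) :
    valForm g p (curvatureAt g p u v w) z =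
      κ * (valForm g p u w * valForm g p v z - valForm g p u z * valForm g p v w) := by
  refine IsLinearMap.eq_of_e (f := fun u => valForm g p (curvatureAt g p u v w) z)
    (f' := fun u => κ * (valForm g p u w * valForm g p v z - valForm g p u z * valForm g p v w))
    ⟨fun _ _ => by simp [curvatureAt, curvature]; ring,
      fun _ _ => by simp [curvatureAt, curvature]; ring⟩
    ⟨fun _ _ => by simp; ring, fun _ _ => by simp; ring⟩ (fun j => ?_) u
  refine IsLinearMap.eq_of_e (f := fun v => valForm g p (curvatureAt g p (e j) v w) z)
    (f' := fun v => κ * (valForm g p (e j) w * valForm g p v z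
      - valForm g p (e j) z * valForm g p v w))
    ⟨fun _ _ => by simp [curvatureAt, curvature]; ring,
      fun _ _ => by simp [curvatureAt, curvature]; ring⟩
    ⟨fun _ _ => by simp; ring, fun _ _ => by simp; ring⟩ (fun k => ?_) v
  refine IsLinearMap.eq_of_e (f := fun w => valForm g p (curvatureAt g p (e j) (e k) w) z)
    (f' := fun w => κ * (valForm g p (e j) w * valForm g p (e k) z
      - valForm g p (e j) z * valForm g p (e k) w))
    ⟨fun _ _ => by simp [curvatureAt, curvature]; ring,
      fun _ _ => by simp [curvatureAt, curvature]; ring⟩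
    ⟨fun _ _ => by simp; ring, fun _ _ => by simp; ring⟩ (fun l => ?_) w
  refine IsLinearMap.eq_of_e (f := fun z => valForm g p (curvatureAt g p (e j) (e k) (e l)) z)
    (f' := fun z => κ * (valForm g p (e j) (e l) * valForm g p (e k) z
      - valForm g p (e j) z * valForm g p (e k) (e l)))
    ⟨by simp, by simp⟩
    ⟨fun _ _ => by simp; ring, fun _ _ => by simp; ring⟩ (fun m => ?_) z
  exact (valForm_curvatureAt_e g p j k l m).trans (h j k l m)

variable {V : Type*} [TopologicalSpace V] [ChartedSpace (Coord (n + 1)) V]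
  [IsManifold (𝓡 (n + 1)) ∞ V] {g : PseudoRiemannianMetric n M}
  {g' : PseudoRiemannianMetric (n + 1) V} {f : M → V}

theorem valForm_localDeriv (hf : IsIsometricHypersurface g g' f) (p : M) (u v : Coord n) :
    valForm g' (f p) (localDeriv f p u) (localDeriv f p v) = valForm g p u v := by
  have h := hf.isometric p u v
  rw [mfderiv_eq_localDeriv hf.smooth] at h
  exact h.symm

/-- The vector-valued second fundamental form at `p`. -/
def secondFormAt (g : PseudoRiemannianMetric n M) (g' : PseudoRiemannianMetric (n + 1) V)
    (f : M → V) (p : M) (u v : Coord n) : Coord (n + 1) :=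
  vectorSecondForm (connectionForm (g.inChart p)) (connectionForm (g'.inChart (f p)))
    (localMap f p) u v (extChartAt (𝓡 n) p p)

theorem eventually_isometric (hf : IsIsometricHypersurface g g' f) (p : M) :
    ∀ᶠ x in 𝓝 (extChartAt (𝓡 n) p p), ∀ u v, bilin (fun i j => g.inChart p x i j) u v
      = bilin (fun i j => g'.inChart (f p) (localMap f p x) i j)
        (fderiv ℝ (localMap f p) x u) (fderiv ℝ (localMap f p) x v) := by
  filter_upwards [val_comp_chart hf.smooth g' p] with x hx u v
  rw [bilin_inChart, bilin_inChart, hf.isometric]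
  exact hx u v

theorem bilin_inChart_self (g : PseudoRiemannianMetric n M) (p : M) :
    bilin (fun i j => g.inChart p (extChartAt (𝓡 n) p p) i j) = valForm g p := by
  rw [g.inChart_self, bilin_metric]

theorem secondFormAt_normal (hf : IsIsometricHypersurface g g' f) (p : M) (u v w : Coord n) :
    valForm g' (f p) (localDeriv f p w) (secondFormAt g g' f p u v) = 0 := by
  have h := vectorSecondForm_normal
    (h := fun y => bilin fun i j => g.inChart p y i j)
    (h' := fun y => bilin fun i j => g'.inChart (f p) y i j)
    (Γ := connectionForm (g.inChart p)) (Γ' := connectionForm (g'.inChart (f p)))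
    (F := localMap f p)
    (eventually_isLeviCivitaAt g p).self_of_nhds
    (by rw [localMap_self]; exact (eventually_isLeviCivitaAt g' (f p)).self_of_nhds)
    (contDiffAt_infty.1 (contDiffAt_localMap hf.smooth p) 2)
    (eventually_isometric hf p) u v w
  rw [localMap_self, bilin_inChart_self] at h
  exact (g'.symm (f p) _ _).trans h

theorem gauss_equation_at (hf : IsIsometricHypersurface g g' f) (p : M) (u v w z : Coord n) :
    valForm g p (curvatureAt g p u v w) z =
      valForm g' (f p) (curvatureAt g' (f p) (localDeriv f p u) (localDeriv f p v)
        (localDeriv f p w)) (localDeriv f p z)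
      + valForm g' (f p) (secondFormAt g g' f p u w) (secondFormAt g g' f p v z)
      - valForm g' (f p) (secondFormAt g g' f p v w) (secondFormAt g g' f p u z) := by
  have h := gauss_equation
    (h := fun y => bilin fun i j => g.inChart p y i j)
    (h' := fun y => bilin fun i j => g'.inChart (f p) y i j)
    (Γ := connectionForm (g.inChart p)) (Γ' := connectionForm (g'.inChart (f p)))
    (F := localMap f p)
    (eventually_isLeviCivitaAt g p)
    (by rw [localMap_self]; exact eventually_isLeviCivitaAt g' (f p))
    (differentiableAt_connectionForm_inChart g p)
    (by rw [localMap_self]; exact differentiableAt_connectionForm_inChart g' (f p))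
    (contDiffAt_infty.1 (contDiffAt_localMap hf.smooth p) 3)
    (eventually_isometric hf p) u v w z
  rw [localMap_self, bilin_inChart_self, bilin_inChart_self] at h
  exact h

/-- The vector-valued form differs from `∇'_{B_j} B_l` only by the image of `Γ(e_j, e_l)`, which is
tangent and so orthogonal to `N`. -/
theorem secondFundamentalForm_eq (hf : IsIsometricHypersurface g g' f) {p : M}
    {N : TangentSpace (𝓡 (n + 1)) (f p)} (hN : IsUnitNormal g' f p N) (j l : Fin n) :
    secondFundamentalForm g' f p N j l
      = valForm g' (f p) (secondFormAt g g' f p (e j) (e l)) N := by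
  have hF : ContDiffAt ℝ 2 (localMap f p) (extChartAt (𝓡 n) p p) :=
    contDiffAt_infty.1 (contDiffAt_localMap hf.smooth p) 2
  have hpd : ∀ (l : Fin n) (μ : Fin (n + 1)) (x : Coord n), DifferentiableAt ℝ (localMap f p) x →
      pd l (fun x => localMap f p x μ) x = fderiv ℝ (localMap f p) x (e l) μ := by
    intro l μ x hx
    have := ((EuclideanSpace.proj μ : Coord (n + 1) →L[ℝ] ℝ).hasFDerivAt.comp x
      hx.hasFDerivAt).fderiv
    exact congrArg (fun L : Coord n →L[ℝ] ℝ => L (e l)) this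
  have hpd2 : ∀ μ, pd j (pd l fun x => localMap f p x μ) (extChartAt (𝓡 n) p p)
      = fderiv ℝ (fderiv ℝ (localMap f p)) (extChartAt (𝓡 n) p p) (e j) (e l) μ := by
    intro μ
    have h1 : (pd l fun x => localMap f p x μ) =ᶠ[𝓝 (extChartAt (𝓡 n) p p)]
        fun x => fderiv ℝ (localMap f p) x (e l) μ := by
      filter_upwards [hF.eventually (by simp)] with x hx
      exact hpd l μ x (hx.differentiableAt (by norm_num))
    have h2 : HasFDerivAt (fderiv ℝ (localMap f p)) _ (extChartAt (𝓡 n) p p) :=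
      ((hF.fderiv_right (m := 1) (by norm_num)).differentiableAt (by norm_num)).hasFDerivAt
    have h3 := ((EuclideanSpace.proj μ : Coord (n + 1) →L[ℝ] ℝ).hasFDerivAt.comp _
      (h2.clm_apply (hasFDerivAt_const (e l) _))).fderiv
    rw [pd, h1.fderiv_eq]
    refine (congrArg (fun L : Coord n →L[ℝ] ℝ => L (e j)) h3).trans ?_
    simp
  have hN0 : ∀ u, valForm g' (f p) (localDeriv f p u) N = 0 := by
    intro u
    have := hN.normal u
    rw [mfderiv_eq_localDeriv hf.smooth] at this
    exact this
  have hE : secondFormAt g g' f p (e j) (e l)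
      = (fderiv ℝ (fderiv ℝ (localMap f p)) (extChartAt (𝓡 n) p p) (e j) (e l)
        + connectionForm (g'.inChart (f p)) (extChartAt (𝓡 (n + 1)) (f p) (f p))
          (localDeriv f p (e j)) (localDeriv f p (e l)))
        - localDeriv f p (connectionForm (g.inChart p) (extChartAt (𝓡 n) p p) (e j) (e l)) := by
    rw [← localMap_self]; rfl
  have hsub : ∀ a b c : Coord (n + 1), valForm g' (f p) (a - b) c
      = valForm g' (f p) a c - valForm g' (f p) b c := fun a b c => by rw [map_sub, sub_apply]
  rw [hE]
  refine Eq.trans ?_ ((hsub _ _ N).trans ((congrArg (_ - ·) (hN0 _)).trans (sub_zero _))).symm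
  refine Eq.trans ?_ (val_eq_sum_lower _ _).symm
  refine Finset.sum_congr rfl fun μ _ => ?_
  rw [mul_comm]
  refine congrArg (· * _) ?_
  rw [hpd2]
  simp only [hpd _ _ _ (hF.differentiableAt (by norm_num)), connectionForm, bilin_apply, coords]
  simp only [PiLp.add_apply, WithLp.ofLp_sum, Finset.sum_apply, PiLp.smul_apply, smul_eq_mul]
  refine congrArg _ (Finset.sum_congr rfl fun α _ => Finset.sum_congr rfl fun β _ => ?_)
  simp only [christoffelAt, localDeriv]
  ring

theorem secondFundamentalForm_isSymm (hf : IsIsometricHypersurface g g' f) {p : M}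
    {N : TangentSpace (𝓡 (n + 1)) (f p)} (hN : IsUnitNormal g' f p N) :
    (Matrix.of (secondFundamentalForm g' f p N)).IsSymm := by
  ext j l
  simp only [Matrix.transpose_apply, Matrix.of_apply]
  rw [secondFundamentalForm_eq hf hN, secondFundamentalForm_eq hf hN]
  have hF : ContDiffAt ℝ 2 (localMap f p) (extChartAt (𝓡 n) p p) :=
    contDiffAt_infty.1 (contDiffAt_localMap hf.smooth p) 2
  have h1 := hF.isSymmSndFDerivAt (by simp) (e l) (e j)
  have h2 := (eventually_isLeviCivitaAt g p).self_of_nhds.torsionFree (e l) (e j)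
  have h3 := (eventually_isLeviCivitaAt g' (f p)).self_of_nhds.torsionFree
  rw [← localMap_self] at h3
  simp only [secondFormAt, vectorSecondForm]
  rw [h1, h2, h3]

theorem nondegenerate_localDeriv (hf : IsIsometricHypersurface g g' f) (p : M) (u : Coord n)
    (hu : ∀ v, valForm g' (f p) (localDeriv f p u) (localDeriv f p v) = 0) : u = 0 :=
  g.nondegenerate p u fun v => (valForm_localDeriv hf p u v).symm.trans (hu v)

theorem finrank_coord_succ : Module.finrank ℝ (Coord (n + 1)) = Module.finrank ℝ (Coord n) + 1 := by
  simp

theorem exists_isUnitNormal (hf : IsIsometricHypersurface g g' f) (p : M) :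
    ∃ N, IsUnitNormal g' f p N := by
  obtain ⟨N, hN, hDN⟩ := exists_unit_normal (B := (valForm g' (f p)).toLinearMap₁₂)
    (D := (localDeriv f p).toLinearMap) finrank_coord_succ
    (fun y z => g'.symm (f p) y z) (fun y hy => g'.nondegenerate (f p) y hy)
    (nondegenerate_localDeriv hf p)
  refine ⟨N, hN, fun u => ?_⟩
  rw [mfderiv_eq_localDeriv hf.smooth]
  exact hDN u

/-- Values of the vector-valued second form lie on the normal line, so their products are `g'(N,N)`
times products of entries of `Ω`; this is the origin of `ε`. -/
theorem isGaussCurvature_secondFundamentalForm (hf : IsIsometricHypersurface g g' f) {p : M}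
    {κ : ℝ} (hκ : ∀ j k l m, lowerLast g' (f p) (riemann g' (f p)) j k l m =
      κ * (metric g' (f p) j l * metric g' (f p) k m - metric g' (f p) j m * metric g' (f p) k l))
    {N : TangentSpace (𝓡 (n + 1)) (f p)} (hN : IsUnitNormal g' f p N) :
    IsGaussCurvature g p κ (g'.val (f p) N N) (Matrix.of (secondFundamentalForm g' f p N)) := by
  intro j k l m
  have hN0 : ∀ u, valForm g' (f p) (localDeriv f p u) N = 0 := by
    intro u
    have := hN.normal u
    rw [mfderiv_eq_localDeriv hf.smooth] at this
    exact this
  have hform : ∀ u v u' v', valForm g' (f p) (secondFormAt g g' f p u v)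
      (secondFormAt g g' f p u' v') = valForm g' (f p) N N
        * (valForm g' (f p) (secondFormAt g g' f p u v) N
          * valForm g' (f p) (secondFormAt g g' f p u' v') N) := fun u v u' v' =>
    form_eq_of_normal (B := (valForm g' (f p)).toLinearMap₁₂)
      (D := (localDeriv f p).toLinearMap) finrank_coord_succ
      (nondegenerate_localDeriv hf p) hN.unit hN0
      (fun w => secondFormAt_normal hf p u v w) (fun w => secondFormAt_normal hf p u' v' w)
  rw [← valForm_curvatureAt_e, gauss_equation_at hf, valForm_curvatureAt_of_constant hκ, hform,
    hform]
  simp only [valForm_localDeriv hf, Matrix.of_apply, secondFundamentalForm_eq hf hN]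
  change κ * (metric g p j l * metric g p k m - metric g p j m * metric g p k l)
    + g'.val (f p) N N * _ - g'.val (f p) N N * _ = _
  ring

end GaussOnManifolds

end

end WeylCompat

/-! ### The main theorem -/

theorem mainTheorem7 {n : ℕ} (hn : 3 ≤ n)
    {M : Type*} [TopologicalSpace M] [ChartedSpace (WeylCompat.Coord n) M] [IsManifold (𝓡 n) ∞ M]
    {V : Type*} [TopologicalSpace V] [ChartedSpace (WeylCompat.Coord (n + 1)) V]
    [IsManifold (𝓡 (n + 1)) ∞ V]
    (g : WeylCompat.PseudoRiemannianMetric n M) (g' : WeylCompat.PseudoRiemannianMetric (n + 1) V)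
    (f : M → V) (hf : WeylCompat.IsIsometricHypersurface g g' f)
    (hV : WeylCompat.HasConstantCurvature g') (p : M) :
    -- the second fundamental form and its eigenvectors
    (∀ N : TangentSpace (𝓡 (n + 1)) (f p), WeylCompat.IsUnitNormal g' f p N →
      WeylCompat.RiemannCompatible g p (WeylCompat.secondFundamentalForm g' f p N) ∧
      WeylCompat.WeylCompatible g p (WeylCompat.secondFundamentalForm g' f p N) ∧
      ∀ (c : ℝ) (u : TangentSpace (𝓡 n) p),
        WeylCompat.IsEigenvector g p (WeylCompat.secondFundamentalForm g' f p N) c u →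
        WeylCompat.VectorCompatible g p (WeylCompat.riemann g p) u ∧
        WeylCompat.VectorCompatible g p (WeylCompat.weyl g p) u) ∧
    -- the Ricci tensor
    WeylCompat.RiemannCompatible g p (WeylCompat.ricci g p) ∧
    WeylCompat.WeylCompatible g p (WeylCompat.ricci g p) ∧
    -- the energy-momentum tensor
    (∀ T : Fin n → Fin n → ℝ, WeylCompat.EinsteinEquation g p T →
      WeylCompat.WeylCompatible g p T ∧
      ∀ (a b : ℝ) (u : TangentSpace (𝓡 n) p), a ≠ 0 → g.val p u u = -1 →
        (∀ k l, T k l = a * WeylCompat.lower g p u k * WeylCompat.lower g p u l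
          + b * WeylCompat.metric g p k l) →
        WeylCompat.VectorCompatible g p (WeylCompat.weyl g p) u ∧
        WeylCompat.WeylPurelyElectric g p u ∧
        ∀ (h : n = 4) (i j : Fin n), WeylCompat.magneticWeyl h g p u i j = 0) := by
  obtain ⟨κ, hκ⟩ := hV
  have hG := fun N (hN : WeylCompat.IsUnitNormal g' f p N) =>
    WeylCompat.isGaussCurvature_secondFundamentalForm hf (hκ (f p)) hN
  have hS := fun N (hN : WeylCompat.IsUnitNormal g' f p N) =>
    WeylCompat.secondFundamentalForm_isSymm hf hN
  -- Here `rfl` proves that `Ω` commutes with itself.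
  refine ⟨fun N hN => ⟨(hG N hN).riemannCompatible (hS N hN) (hS N hN) rfl,
    (hG N hN).weylCompatible (hS N hN) (hS N hN) rfl,
    fun c u hu => (hG N hN).vectorCompatible hu⟩, ?_⟩
  -- The remaining claims mention no normal, so any unit normal at `p` serves to express the
  -- curvature.
  obtain ⟨N, hN⟩ := WeylCompat.exists_isUnitNormal hf p
  have hGN := hG N hN
  have hSN := hS N hN
  have hRic := hGN.ricci_isSymm hSN
  have hRicΩ := (WeylCompat.MetricCommute.ricci hGN rfl).symm
  have hmetric := (WeylCompat.metricCommute_metric (g := g) (p := p)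
    (Matrix.of (WeylCompat.secondFundamentalForm g' f p N))).symm
  refine ⟨hGN.riemannCompatible hSN hRic hRicΩ, hGN.weylCompatible hSN hRic hRicΩ,
    fun T hT => ?_⟩
  -- Einstein's equations make `T` a linear combination of Ricci and `g`, so it commutes with `Ω`.
  have hTeq : Matrix.of T = (8 * Real.pi)⁻¹ • (Matrix.of (WeylCompat.ricci g p)
      - (WeylCompat.scalar g p / 2) • WeylCompat.metric g p) := by
    ext i j
    have := hT i j
    have hpi : (8 * Real.pi) ≠ 0 := by positivity
    simp only [Matrix.smul_apply, Matrix.sub_apply, Matrix.of_apply, smul_eq_mul]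
    rw [this, inv_mul_cancel_left₀ hpi]
  have hTsymm : (Matrix.of T).IsSymm := by
    rw [hTeq]
    exact (hRic.sub ((WeylCompat.metric_isSymm g p).smul _)).smul _
  have hTΩ : WeylCompat.MetricCommute g p (Matrix.of T)
      (Matrix.of (WeylCompat.secondFundamentalForm g' f p N)) := by
    unfold WeylCompat.MetricCommute at hRicΩ hmetric ⊢
    rw [hTeq]
    simp only [Matrix.smul_mul, Matrix.mul_smul, sub_mul, mul_sub, hRicΩ, hmetric]
  have hTW : WeylCompat.WeylCompatible g p T := hGN.weylCompatible hSN hTsymm hTΩ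
  refine ⟨hTW, fun a b u ha hu hTu => ?_⟩
  -- The metric commutes with `Ω` and is therefore Weyl compatible, which allows `b g` to be removed
  -- from `T`.
  have huW : WeylCompat.VectorCompatible g p (WeylCompat.weyl g p) u :=
    WeylCompat.CovectorCompatible.of_tensorCompatible ha hTW
      (hGN.weylCompatible hSN (WeylCompat.metric_isSymm g p) hmetric) hTu
  exact ⟨huW, WeylCompat.weylPurelyElectric_of_vectorCompatible huW hu,
    fun h i j => WeylCompat.magneticWeyl_eq_zero_of_vectorCompatible huW hu h i j⟩
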